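/- Let $d\ge 0$, $N\ge 1$ be integers and $0<q<1$. Let $y_1>\dots>y_d$ be integers with $y_d\ge -d$ (if $d\geq 1$), put $y_{d+j}:=-d-j$ for $1\le j\le N$, and let $x_1>\dots>x_{d+N}\ge -d-N$ be integers (in the geometric model $x_{d+N}=-d-N$). A *configuration of red dots* is a family $(x^{(k)})_{0\le k\le N}$, $x^{(k)}=(x^{(k)}_1>\dots>x^{(k)}_{d+k})\in\mathbb Z^{d+k}$, with $x^{(0)}_i=y_i$ $(1\le i\le d)$, $x^{(N)}_i=x_i$ $(1\le i\le d+N)$ and $$x^{(k)}_{i+1}<x^{(k-1)}_i\le x^{(k)}_i\qquad(1\le k\le N,\ 1\le i\le d+k-1).$$ Assume that at least one configuration exists. Let $h_r(a_1,\dots,a_n)$ be the complete homogeneous symmetric polynomial, defined by $\prod_i(1-a_iz)^{-1}=\sum_{r\ge0}h_rz^r$, with $h_r=0$ for $r<0$. Put $\nu^{(k)}_i:=x^{(k)}_i+i$, $|\nu^{(k)}|:=\sum_{i=1}^{d+k}\nu_i^{(k)}$, $\lambda_i:=x_i+i$, $\mu_i:=y_i+i$ $(1\le i\le d+N)$, $s_{\lambda\backslash\mu}(a):=\det(h_{\lambda_i-i-\mu_j+j}(a))_{1\le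 i,j\le d+N}$, and let $\mathbb P_q$ be the measure on configurations giving to $(x^{(k)})_k$ the mass $$\frac{(q^{-1})^{\sum_{k=1}^{N-1}|\nu^{(k)}|-(N-1)|\nu^{(0)}|}}{s_{\lambda\backslash\mu}(q^{1-N},q^{2-N},\dots,q^{0})}.$$ Let $H:=(h_{x_i-y_j}(q^d,q^{d+1},\dots,q^{d+N-1}))_{1\le i,j\le d+N}$, let $\mathrm{virt}$ be an extra symbol, and put, for $z\in\mathbb Z$, $$\chi_i(z):=\mathbf 1_{z=y_i}\ (1\le i\le d),\qquad \psi_i(z):=\sum_{j=1}^{d+N}(H^{-1})_{ij}\mathbf 1_{z=x_j}\ (1\le i\le d+N),$$ $$\varphi_k(x,z):=q^{(k-1)(z-x)}\mathbf 1_{x\le z}\ (x\in\mathbb Z),\qquad \varphi_k(\mathrm{virt},z):=q^{(k-1)z}\qquad (k\ge 1).$$ Let $*$ denote summation over $\mathbb Z$ in the common variable, let $\varphi^{a,b}:=\varphi_a*\varphi_{a+1}*\dots*\varphi_{b-1}$ on $\mathbb Z\times\mathbb Z$ for $a<b$, and let $\varphi^{a,a}(x,y):=\mathbf 1_{x=y}$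 be the identity kernel. For $0\le m\le N$ and $1\le k\le d+N$ put $\psi^{(m+1)}_k:=\varphi^{d+m+1,d+N+1}*\psi_k$ (so $\psi_k^{(N+1)}=\psi_k$), and for $1\le k,\ell\le d+N$ put $$M_{k\ell}:=\begin{cases}\chi_k*\psi^{(1)}_\ell,&1\le k\le d,\\ \varphi_k(\mathrm{virt},\cdot)*\psi^{(k+1-d)}_\ell,&d+1\le k\le d+N.\end{cases}$$ Then $\mathbb P_q$ is a probability measure, $H$ and $M$ are invertible, all the series above and below converge, and the point process of red dots $\{(k,x^{(k)}_i):0\le k\le N,\ 1\le i\le d+k\}\subset\{0,\dots,N\}\times\mathbb Z$ under $\mathbb P_q$ is determinantal with the kernel, for $0\le m,n\le N$ and $x,y\in\mathbb Z$, $$\begin{aligned}\mathbb K_q(m,x;n,y)=&-\mathbf 1_{m<n}\,(\varphi_{d+m+1}*\dots*\varphi_{d+n})(x,y)\\&+\sum_{k=1}^{d+N}\sum_{\ell=1}^{d}\psi^{(m+1)}_k(x)\,(M^{-1})_{k\ell}\,(\chi_\ell*\varphi^{d+1,d+1+n})(y)\\&+\sum_{k=1}^{d+N}\sum_{\ell=d+1}^{d+n}\psi^{(m+1)}_k(x)\,(M^{-1})_{k\ell}\,\bigl(\varphi_\ell(\mathrm{virt},\cdot)*\varphi^{\ell+1,d+1+n}\bigr)(y);\end{aligned}$$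 that is, for any distinct points $p_1,\dots,p_r\in\{0,\dots,N\}\times\mathbb Z$ the probability that all $p_i$ are red dots is $\det(\mathbb K_q(p_i;p_j))_{1\le i,j\le r}$. -/

import Mathlib

open MeasureTheory

noncomputable section

namespace RedDots

/-! Conventions: the mathematical indices `1, …, n` become `Fin n`, so that the mathematical index
of `i : Fin n` is `i + 1`. Levels `0, …, N` are indexed by `Fin (N + 1)`. -/

/-- The complete homogeneous symmetric polynomial `h_r(a_1, …, a_n)`: the coefficient of `z ^ r` in
`∏ i, (1 - a i z)⁻¹`, and `0` for `r < 0`. -/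
def h {n : ℕ} (r : ℤ) (a : Fin n → ℝ) : ℝ :=
  if 0 ≤ r then
    PowerSeries.coeff r.toNat (∏ i, (1 - PowerSeries.C (a i) * PowerSeries.X : PowerSeries ℝ)⁻¹)
  else 0

/-- The skew Schur polynomial `det (h_{λ_i - i - μ_j + j}(a))` (the shift of the indices by one
cancels in `- i + j`). -/
def skewSchur {n N : ℕ} (lam mu : Fin n → ℤ) (a : Fin N → ℝ) : ℝ :=
  (Matrix.of fun i j : Fin n => h (lam i - (i : ℤ) - mu j + (j : ℤ)) a).det

/-- The points `y_1 > ⋯ > y_d`, completed by `y_{d+j} = -d-j` for `1 ≤ j ≤ N`. -/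
def yExt {d : ℕ} (N : ℕ) (y : Fin d → ℤ) : Fin (d + N) → ℤ :=
  Fin.append y fun j : Fin N => -((d : ℤ) + (j : ℤ) + 1)

/-- A configuration of red dots: at level `k` (for `0 ≤ k ≤ N`) there are dots at
`x^{(k)}_1 > ⋯ > x^{(k)}_{d+k}`, consecutive levels interlace,
`x^{(k+1)}_{i+1} < x^{(k)}_i ≤ x^{(k+1)}_i`, and the levels `0` and `N` are prescribed. -/
structure Config {d N : ℕ} (y : Fin d → ℤ) (x : Fin (d + N) → ℤ) where
  row : (k : Fin (N + 1)) → Fin (d + k) → ℤ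
  strictAnti : ∀ k, StrictAnti (row k)
  interlace : ∀ (k : ℕ) (hk : k < N) (i : ℕ) (hi : i < d + k),
    row ⟨k + 1, Nat.succ_lt_succ hk⟩ ⟨i + 1, Nat.succ_lt_succ hi⟩
        < row ⟨k, Nat.lt_succ_of_lt hk⟩ ⟨i, hi⟩ ∧
      row ⟨k, Nat.lt_succ_of_lt hk⟩ ⟨i, hi⟩
        ≤ row ⟨k + 1, Nat.succ_lt_succ hk⟩ ⟨i, Nat.lt_succ_of_lt hi⟩
  bottom : ∀ i : Fin d, row ⟨0, Nat.succ_pos N⟩ i = y i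
  top : ∀ i : Fin (d + N), row ⟨N, Nat.lt_succ_self N⟩ i = x i

variable {d N : ℕ}

/-- The set of red dots `(k, x^{(k)}_i)` of a configuration. -/
def Config.dots {y : Fin d → ℤ} {x : Fin (d + N) → ℤ} (c : Config y x) : Set (Fin (N + 1) × ℤ) :=
  {p | ∃ i, c.row p.1 i = p.2}

/-- The parts `ν^{(k)}_i = x^{(k)}_i + i` of the partition attached to level `k`. -/
def Config.nu {y : Fin d → ℤ} {x : Fin (d + N) → ℤ} (c : Config y x) (k : Fin (N + 1))
    (i : Fin (d + k)) : ℤ :=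
  c.row k i + ((i : ℤ) + 1)

/-- The size `|ν^{(k)}|`. -/
def Config.size {y : Fin d → ℤ} {x : Fin (d + N) → ℤ} (c : Config y x) (k : Fin (N + 1)) : ℤ :=
  ∑ i, c.nu k i

/-- The `q`-weight of a configuration,
`q⁻¹ ^ (∑_{1 ≤ k ≤ N-1} |ν^{(k)}| - (N-1) |ν^{(0)}|) / s_{λ∖μ}(q^{1-N}, q^{2-N}, …, q^0)`,
where `λ_i = x_i + i` and `μ_i = y_i + i` for `1 ≤ i ≤ d + N`. -/
def qWeight (q : ℝ) {y : Fin d → ℤ} {x : Fin (d + N) → ℤ} (c : Config y x) : ℝ :=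
  (q⁻¹) ^ ((∑ k ∈ Finset.Ioo 0 (Fin.last N), c.size k) - ((N : ℤ) - 1) * c.size 0) /
    skewSchur (fun i => x i + ((i : ℤ) + 1)) (fun i => yExt N y i + ((i : ℤ) + 1))
      (fun j : Fin N => q ^ (1 - (N : ℤ) + (j : ℤ)))

instance (y : Fin d → ℤ) (x : Fin (d + N) → ℤ) : MeasurableSpace (Config y x) := ⊤

/-- The measure `ℙ_q` on configurations, giving mass `qWeight q c` to `c`. -/
def measureQ (q : ℝ) (y : Fin d → ℤ) (x : Fin (d + N) → ℤ) : Measure (Config y x) :=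
  Measure.sum fun c => ENNReal.ofReal (qWeight q c) • Measure.dirac c

/-- The random subset `X` of the discrete space `E` is a determinantal point process with kernel
`K`: the probability that `X` contains given distinct points `p_1, …, p_r` is
`det (K (p_i, p_j))`. -/
def IsDeterminantal {Ω E : Type*} [MeasurableSpace Ω] (P : Measure Ω) (X : Ω → Set E)
    (K : E → E → ℝ) : Prop :=
  ∀ (r : ℕ) (p : Fin r → E), Function.Injective p →
    P.real {ω | ∀ i, p i ∈ X ω} = (Matrix.of fun i j => K (p i) (p j)).det

/-- The matrix `H_{ij} = h_{x_i - y_j}(q^d, q^{d+1}, …, q^{d+N-1})`. -/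
def H (q : ℝ) (y : Fin d → ℤ) (x : Fin (d + N) → ℤ) : Matrix (Fin (d + N)) (Fin (d + N)) ℝ :=
  Matrix.of fun i j => h (x i - yExt N y j) (fun t : Fin N => q ^ (d + (t : ℕ)))

/-- `χ_i(z) = 1_{z = y_i}`. -/
def chi (y : Fin d → ℤ) (i : Fin d) (z : ℤ) : ℝ := if z = y i then 1 else 0

/-- `φ_k(x, z)` for `x ∈ {virt} ∪ ℤ`; the virtual point, a point at `-∞`, is `⊥ : WithBot ℤ`. -/
def phi (q : ℝ) (k : ℕ) : WithBot ℤ → ℤ → ℝ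
  | ⊥, z => q ^ (((k : ℤ) - 1) * z)
  | (x : ℤ), z => if x ≤ z then q ^ (((k : ℤ) - 1) * (z - x)) else 0

/-- The convolution `φ_a * φ_{a+1} * ⋯ * φ_{a+l-1}` on `ℤ × ℤ` of `l` factors; the empty
convolution is the identity kernel. -/
def phiIter (q : ℝ) (a : ℕ) : ℕ → ℤ → ℤ → ℝ
  | 0, x, y => if x = y then 1 else 0
  | l + 1, x, y => ∑' z : ℤ, phiIter q a l x z * phi q (a + l) (z : WithBot ℤ) y

/-- `φ^{a,b} = φ_a * ⋯ * φ_{b-1}` for `a ≤ b`, with `φ^{a,a}` the identity kernel. -/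
def phiConv (q : ℝ) (a b : ℕ) : ℤ → ℤ → ℝ := phiIter q a (b - a)

/-- `ψ_k(z) = ∑_j (H⁻¹)_{kj} 1_{z = x_j}`. -/
def psi (q : ℝ) (y : Fin d → ℤ) (x : Fin (d + N) → ℤ) (k : Fin (d + N)) (z : ℤ) : ℝ :=
  ∑ j, (H q y x)⁻¹ k j * if z = x j then 1 else 0

/-- `psiLevel q y x m k` is `ψ_k^{(m+1)} = φ^{d+m+1,d+N+1} * ψ_k`, for `0 ≤ m ≤ N`; in particular
`ψ_k^{(N+1)} = ψ_k`. -/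
def psiLevel (q : ℝ) (y : Fin d → ℤ) (x : Fin (d + N) → ℤ) (m : ℕ) (k : Fin (d + N)) (u : ℤ) : ℝ :=
  ∑' z : ℤ, phiConv q (d + m + 1) (d + N + 1) u z * psi q y x k z

/-- The matrix `M`: its first `d` rows are `χ_k * ψ_ℓ^{(1)}`, and row `k = d + (j + 1)`, for
`0 ≤ j < N`, is `φ_k(virt, ·) * ψ_ℓ^{(k+1-d)}`. -/
def M (q : ℝ) (y : Fin d → ℤ) (x : Fin (d + N) → ℤ) : Matrix (Fin (d + N)) (Fin (d + N)) ℝ :=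
  Matrix.of fun k l =>
    Fin.addCases
      (fun i : Fin d => ∑' z : ℤ, chi y i z * psiLevel q y x 0 l z)
      (fun j : Fin N => ∑' z : ℤ, phi q (d + (j + 1)) ⊥ z * psiLevel q y x (j + 1) l z)
      k

/-- The kernel `𝕂_q(m, u; n, v)`, for `0 ≤ m, n ≤ N`. In the last sum `j : Fin N` stands for `ℓ = d + (j + 1)`, and
`ℓ ≤ d + n` means `j < n`. -/
def kernel (q : ℝ) (y : Fin d → ℤ) (x : Fin (d + N) → ℤ) (m : ℕ) (u : ℤ) (n : ℕ) (v : ℤ) :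
    ℝ :=
  -(if m < n then phiConv q (d + m + 1) (d + n + 1) u v else 0) +
    (∑ k : Fin (d + N), ∑ l : Fin d,
      psiLevel q y x m k u * (M q y x)⁻¹ k (Fin.castAdd N l) *
        (∑' z : ℤ, chi y l z * phiConv q (d + 1) (d + 1 + n) z v)) +
    (∑ k : Fin (d + N), ∑ j ∈ Finset.univ.filter (fun j : Fin N => (j : ℕ) < n),
      psiLevel q y x m k u * (M q y x)⁻¹ k (Fin.natAdd d j) *
        (∑' z : ℤ, phi q (d + (j + 1)) ⊥ z * phiConv q (d + (j + 1) + 1) (d + 1 + n) z v))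

end RedDots

end

noncomputable section

namespace RedDots

/-! ### Interlacing sums of determinants -/

/-! Everything rests on a Lindström–Gessel–Viennot formula with virtual points, `det_eq_sum_weight`.
Start from the indicators of the y_i; let each function f at level k evolve into a solution of F(z)
- a_k F(z-1) = ω_k(z) f(z), and let a homogeneous solution v_k a_k^z enter at each level. In the
determinant at the top level, subtracting from each column a multiple of the next one kills the
newest row except for its last entry and turns the other entries into sums over the interlacing
intervals. So the determinant unfolds, level by level, into a weighted sum over configurations.

The formula serves three systems. For `hRow` it is Jacobi–Trudi: det H and the skew Schur function
are sums of positive terms, hence H is invertible and ℙ_q is normalised. For `baseRow`, the rows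
built from χ_i and the virtual points, it evaluates det G with G = `topMatrix`. Since M = G H⁻ᵀ, the
matrix H drops out of the kernel, which at given points reads K = C G⁻¹ R - S, with C the
transitions to the top (`toTopMatrix`), R the row values (`rowMatrix`) and S the `stepMatrix`. For
`pertRow`, a dot at a given point has weight 1 + t; the perturbed rows are explicit, and det(1 + AB)
= det(1 + BA) gives det G · det(1 + tK) as the generating function of the number of covered points.
Its coefficient of t^r is det G · det K. The weight attached to G differs from the q-weight by a
constant factor (`exists_plainWeight_eq`), which cancels on normalising. -/

/-- The sequences `x` with `z (i + 1) < x i ≤ z i` for all `i`. -/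
def interlacers {n : ℕ} (z : Fin (n + 1) → ℤ) : Finset (Fin n → ℤ) :=
  Fintype.piFinset fun i => Finset.Ioc (z i.succ) (z i.castSucc)

lemma mem_interlacers {n : ℕ} {z : Fin (n + 1) → ℤ} {x : Fin n → ℤ} :
    x ∈ interlacers z ↔ ∀ i, z i.succ < x i ∧ x i ≤ z i.castSucc := by
  simp [interlacers]

lemma strictAnti_of_mem_interlacers {n : ℕ} {z : Fin (n + 1) → ℤ} {x : Fin n → ℤ}
    (hz : StrictAnti z) (hx : x ∈ interlacers z) : StrictAnti x := by
  rw [mem_interlacers] at hx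
  intro i j hij
  have h : z j.castSucc ≤ z i.succ := hz.antitone (Fin.succ_le_castSucc_iff.2 hij)
  linarith [(hx j).2, (hx i).1]

/-- Subtracting from each column a multiple of the next one does not change the determinant. -/
lemma det_eq_of_forall_col_eq_add_smul_succ {R : Type*} [CommRing R] {n : ℕ}
    {A B : Matrix (Fin (n + 1)) (Fin (n + 1)) R} (c : Fin n → R)
    (hlast : ∀ i, A i (Fin.last n) = B i (Fin.last n))
    (hcol : ∀ i (j : Fin n), A i j.castSucc = B i j.castSucc + c j * A i j.succ) :
    A.det = B.det := by
  -- Reversing rows and columns turns the next column into the previous one.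
  rw [← Matrix.det_submatrix_equiv_self Fin.revPerm A,
    ← Matrix.det_submatrix_equiv_self Fin.revPerm B]
  refine Matrix.det_eq_of_forall_col_eq_smul_add_pred (fun j => c j.rev) ?_ ?_
  · intro i
    simpa using hlast i.rev
  · intro i j
    simpa [Fin.rev_succ, Fin.rev_castSucc] using hcol i.rev j.rev

/-- Divided by `a ^ w`, the difference equation telescopes over the interval. -/
lemma sub_zpow_mul_eq_sum_Ioc {a : ℝ} (ha : a ≠ 0) {f F : ℤ → ℝ}
    (hF : ∀ w, F w - a * F (w - 1) = f w) {lo hi : ℤ} (h : lo ≤ hi) :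
    F hi - a ^ (hi - lo) * F lo = ∑ w ∈ Finset.Ioc lo hi, a ^ (hi - w) * f w := by
  induction hi, h using Int.leInduction with
  | base => simp
  | succ hi h ih =>
    have hins : Finset.Ioc lo (hi + 1) = insert (hi + 1) (Finset.Ioc lo hi) := by
      ext w
      simp only [Finset.mem_Ioc, Finset.mem_insert]
      omega
    have hpow : ∀ w, a ^ (hi + 1 - w) = a * a ^ (hi - w) := fun w => by
      rw [← zpow_one_add₀ ha]
      congr 1
      ring
    have h1 := hF (hi + 1)
    rw [add_sub_cancel_right] at h1
    rw [hins, Finset.sum_insert (by simp)]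
    simp_rw [hpow, mul_assoc]
    rw [← Finset.mul_sum, ← ih, ← h1]
    have : a * a ^ (hi - (hi + 1)) = 1 := by rw [← hpow]; simp
    rw [← mul_assoc a (a ^ (hi - (hi + 1))), this]
    ring

/-- If `F i` solves the difference equation `F i w - a * F i (w - 1) = f i w`, then the determinant
of the `F i (z j)`, bordered by a row `v * a ^ z j`, is the sum of the determinants of the
`f i (x j)` over the sequences `x` interlacing with `z`. -/
theorem det_bordered_eq_sum_interlacers {n : ℕ} {z : Fin (n + 1) → ℤ} (hz : StrictAnti z)
    {a : ℝ} (ha : a ≠ 0) (v : ℝ) {f F : Fin n → ℤ → ℝ}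
    (hF : ∀ i w, F i w - a * F i (w - 1) = f i w)
    (A : Matrix (Fin (n + 1)) (Fin (n + 1)) ℝ) (hA : ∀ i j, A i.castSucc j = F i (z j))
    (hlast : ∀ j, A (Fin.last n) j = v * a ^ z j) :
    A.det = ∑ x ∈ interlacers z,
      v * a ^ (∑ j, z j - ∑ j, x j) * (Matrix.of fun i j => f i (x j)).det := by
  -- The multiplier is the ratio of neighbouring entries of the row `v * a ^ z j`, so that row is
  -- annihilated in every column but the last.
  set B : Matrix (Fin (n + 1)) (Fin (n + 1)) ℝ := Matrix.of fun i j =>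
    Fin.lastCases (motive := fun _ => ℝ) (A i (Fin.last n))
      (fun j => A i j.castSucc - a ^ (z j.castSucc - z j.succ) * A i j.succ) j with hB
  have hBlast : ∀ i, B i (Fin.last n) = A i (Fin.last n) := fun i => by simp [hB]
  have hBcol : ∀ i (j : Fin n),
      B i j.castSucc = A i j.castSucc - a ^ (z j.castSucc - z j.succ) * A i j.succ :=
    fun i j => by simp [hB]
  have hAB : A.det = B.det :=
    det_eq_of_forall_col_eq_add_smul_succ (fun j => a ^ (z j.castSucc - z j.succ))
      (fun i => (hBlast i).symm) (fun i j => by rw [hBcol]; ring)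
  have hBzero : ∀ j : Fin n, B (Fin.last n) j.castSucc = 0 := fun j => by
    rw [hBcol, hlast, hlast, mul_left_comm, ← zpow_add₀ ha]
    simp
  have hminor : B.submatrix Fin.castSucc Fin.castSucc =
      (Matrix.of fun j i : Fin n => ∑ w ∈ Finset.Ioc (z j.succ) (z j.castSucc),
        a ^ (z j.castSucc - w) * f i w).transpose := by
    ext i j
    simp only [Matrix.submatrix_apply, Matrix.transpose_apply, Matrix.of_apply]
    rw [hBcol, hA, hA]
    exact sub_zpow_mul_eq_sum_Ioc ha (hF i) (hz.antitone (Fin.castSucc_lt_succ).le)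
  rw [hAB, Matrix.det_succ_row B (Fin.last n), Fin.sum_univ_castSucc]
  simp only [hBzero, mul_zero, zero_mul, Finset.sum_const_zero, zero_add, Fin.succAbove_last]
  rw [hminor, Matrix.det_transpose, hBlast, hlast, ← two_mul, pow_mul, neg_one_sq, one_pow, one_mul]
  -- Each row of the transposed minor is a sum over its own interval; multilinearity yields one term
  -- per choice of a point in every interval, that is, per interlacing sequence.
  have hexp : (Matrix.of fun j i : Fin n => ∑ w ∈ Finset.Ioc (z j.succ) (z j.castSucc),
        a ^ (z j.castSucc - w) * f i w).det =
      ∑ x ∈ interlacers z, (∏ j, a ^ (z j.castSucc - x j)) *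
        (Matrix.of fun i j => f i (x j)).det := by
    have hrow : (Matrix.of fun j i : Fin n => ∑ w ∈ Finset.Ioc (z j.succ) (z j.castSucc),
        a ^ (z j.castSucc - w) * f i w) = fun j => ∑ w ∈ Finset.Ioc (z j.succ) (z j.castSucc),
        a ^ (z j.castSucc - w) • fun i => f i w := by
      ext j i
      simp [Finset.sum_apply]
    rw [hrow]
    refine ((Matrix.detRowAlternating (R := ℝ) (n := Fin n)).toMultilinearMap.map_sum_finset
      (fun j w => a ^ (z j.castSucc - w) • fun i => f i w) _).trans ?_
    refine Finset.sum_congr rfl fun x _ => ?_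
    refine ((Matrix.detRowAlternating (R := ℝ) (n := Fin n)).toMultilinearMap.map_smul_univ
      (fun j => a ^ (z j.castSucc - x j)) (fun j i => f i (x j))).trans ?_
    rw [smul_eq_mul, ← Matrix.det_transpose]
    rfl
  rw [hexp, Finset.mul_sum]
  refine Finset.sum_congr rfl fun x _ => ?_
  have hprod : ∀ s : Finset (Fin n), ∏ j ∈ s, a ^ (z j.castSucc - x j) =
      a ^ (∑ j ∈ s, (z j.castSucc - x j)) := fun s => by
    induction s using Finset.cons_induction with
    | empty => simp
    | cons j s hj ih => rw [Finset.prod_cons, Finset.sum_cons, ih, zpow_add₀ ha]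
  rw [hprod, ← mul_assoc, mul_assoc v, ← zpow_add₀ ha, Finset.sum_sub_distrib,
    Fin.sum_univ_castSucc z]
  congr 3
  ring

/-! ### Sums over configurations -/

variable {d N : ℕ} {y : Fin d → ℤ}

lemma Config.ext_row {x : Fin (d + N) → ℤ} {c c' : Config y x} (h : ∀ k, c.row k = c'.row k) :
    c = c' := by
  obtain ⟨r, _, _, _, _⟩ := c
  obtain ⟨r', _, _, _, _⟩ := c'
  obtain rfl : r = r' := funext h
  rfl

/-- The configuration up to level `N` obtained by forgetting level `N + 1`. -/
def Config.truncate {x : Fin (d + (N + 1)) → ℤ} (c : Config y x) :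
    Config (N := N) y (c.row (Fin.last N).castSucc) where
  row k := c.row k.castSucc
  strictAnti k := c.strictAnti k.castSucc
  interlace k hk i hi := c.interlace k (Nat.lt_succ_of_lt hk) i hi
  bottom := c.bottom
  top _ := rfl

/-- The extension of a configuration by one more level. -/
def Config.extend {x : Fin (d + (N + 1)) → ℤ} (hx : StrictAnti x) {x' : Fin (d + N) → ℤ}
    (hx' : x' ∈ interlacers (n := d + N) x) (c : Config y x') : Config (N := N + 1) y x where
  row k i := if h : (k : ℕ) < N + 1 then c.row ⟨k, h⟩ i else x ⟨i, by omega⟩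
  strictAnti k := by
    by_cases h : (k : ℕ) < N + 1
    · simpa [h] using c.strictAnti ⟨k, h⟩
    · simp only [h, dite_false]
      exact fun i j hij => hx hij
  interlace k hk i hi := by
    have hk' : k < N + 1 := hk
    rcases Nat.lt_succ_iff_lt_or_eq.1 hk with h | rfl
    · have h' : k + 1 < N + 1 := by omega
      simpa [hk', h'] using c.interlace k h i hi
    · have htop := c.top ⟨i, hi⟩
      have := mem_interlacers.1 hx' ⟨i, hi⟩
      simp only [hk', dite_true, lt_irrefl, dite_false, htop]
      exact this
  bottom i := by simpa using c.bottom i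
  top i := by simp

lemma Config.extend_row_castSucc {x : Fin (d + (N + 1)) → ℤ} (hx : StrictAnti x)
    {x' : Fin (d + N) → ℤ} (hx' : x' ∈ interlacers (n := d + N) x) (c : Config y x')
    (k : Fin (N + 1)) : (c.extend hx hx').row k.castSucc = c.row k := by
  funext i
  have : ((k.castSucc : Fin (N + 2)) : ℕ) < N + 1 := k.2
  simp only [Config.extend, this, dite_true]
  rfl

lemma Config.row_last {x : Fin (d + N) → ℤ} (c : Config y x) : c.row (Fin.last N) = x :=
  funext c.top

lemma Config.row_zero {x : Fin (d + N) → ℤ} (c : Config y x) : c.row 0 = y :=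
  funext c.bottom

lemma Config.truncate_mem_interlacers {x : Fin (d + (N + 1)) → ℤ} (c : Config y x) :
    c.row (Fin.last N).castSucc ∈ interlacers (n := d + N) x := by
  refine mem_interlacers.2 fun i => ?_
  have h := c.interlace N (Nat.lt_succ_self N) i i.2
  have h1 := c.top i.succ
  have h2 := c.top i.castSucc
  rw [← h1, ← h2]
  exact h

/-- Peeling off the top level is the induction step both for finiteness and for sums over
configurations. -/
lemma Config.extend_bijective {x : Fin (d + (N + 1)) → ℤ} (hx : StrictAnti x) :
    Function.Bijective (fun p : Σ x' : interlacers (n := d + N) x, Config y x'.1 =>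
      p.2.extend hx p.1.2) := by
  constructor
  · rintro ⟨⟨x₁, h₁⟩, c₁⟩ ⟨⟨x₂, h₂⟩, c₂⟩ h
    have hrow : ∀ k : Fin (N + 1), c₁.row k = c₂.row k := fun k => by
      rw [← c₁.extend_row_castSucc hx h₁, ← c₂.extend_row_castSucc hx h₂]
      exact congrArg (fun c : Config (N := N + 1) y x => c.row k.castSucc) h
    have hx12 : x₁ = x₂ := c₁.row_last.symm.trans ((hrow _).trans c₂.row_last)
    subst hx12
    obtain rfl : c₁ = c₂ := Config.ext_row hrow
    rfl
  · intro c
    refine ⟨⟨⟨_, c.truncate_mem_interlacers⟩, c.truncate⟩, Config.ext_row fun k => ?_⟩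
    induction k using Fin.lastCases with
    | last => rw [Config.row_last, Config.row_last]
    | cast k => exact Config.extend_row_castSucc hx _ _ k

lemma Config.finite (y : Fin d → ℤ) : ∀ {N : ℕ} {x : Fin (d + N) → ℤ}, StrictAnti x →
    Finite (Config y x)
  | 0, x, _ => by
    have : Subsingleton (Config y x) := ⟨fun c c' => Config.ext_row fun k => by
      obtain rfl : k = 0 := Subsingleton.elim (α := Fin 1) _ _
      rw [c.row_zero, c'.row_zero]⟩
    infer_instance
  | N + 1, x, hx => by
    have : ∀ x' : interlacers (n := d + N) x, Finite (Config y x'.1) := fun x' =>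
      Config.finite y (strictAnti_of_mem_interlacers hx x'.2)
    exact Finite.of_surjective _ (Config.extend_bijective (y := y) hx).2

/-- The product of the transition weights `v k * a k ^ (∑ i, row (k+1) i - ∑ i, row k i)` and of the
weights `ω k z` of the dots below the top level. -/
def Config.weight (a v : ℕ → ℝ) (ω : ℕ → ℤ → ℝ) {x : Fin (d + N) → ℤ} (c : Config y x) : ℝ :=
  ∏ k : Fin N, (v k * a k ^ (∑ i, c.row k.succ i - ∑ i, c.row k.castSucc i) *
    ∏ i, ω k (c.row k.castSucc i))

lemma Config.weight_extend (a v : ℕ → ℝ) (ω : ℕ → ℤ → ℝ) {x : Fin (d + (N + 1)) → ℤ}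
    (hx : StrictAnti x) {x' : Fin (d + N) → ℤ} (hx' : x' ∈ interlacers (n := d + N) x)
    (c : Config y x') :
    (c.extend hx hx').weight a v ω =
      c.weight a v ω * (v N * a N ^ (∑ i, x i - ∑ i, x' i) * ∏ i, ω N (x' i)) := by
  rw [Config.weight, Fin.prod_univ_castSucc]
  congr 1
  · refine Finset.prod_congr rfl fun k _ => ?_
    have h1 := c.extend_row_castSucc hx hx' k.castSucc
    have h2 : (c.extend hx hx').row k.castSucc.succ = c.row k.succ :=
      c.extend_row_castSucc hx hx' k.succ
    rw [h1, h2]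
    rfl
  · have h1 := c.extend_row_castSucc hx hx' (Fin.last N)
    have h2 : (c.extend hx hx').row (Fin.last N).succ = x := (c.extend hx hx').row_last
    rw [h1, h2, c.row_last]
    rfl

lemma det_indicator_eq_one {x : Fin d → ℤ} (hx : StrictAnti x) :
    (Matrix.of fun i j => if x j = x i then (1 : ℝ) else 0).det = 1 := by
  rw [← Matrix.det_one (n := Fin d)]
  congr 1
  ext i j
  simp [Matrix.one_apply, hx.injective.eq_iff, eq_comm]

/-- A nonzero determinant forces every `x j` to be some `y i`; as both sequences decrease strictly,
the matching is increasing, hence the identity. -/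
lemma det_indicator_eq_zero {x : Fin d → ℤ} (hx : StrictAnti x) (hy : StrictAnti y) (h : x ≠ y) :
    (Matrix.of fun i j => if x j = y i then (1 : ℝ) else 0).det = 0 := by
  by_contra hdet
  have hex : ∀ j, ∃ i, x j = y i := by
    intro j
    by_contra! hj
    exact hdet (Matrix.det_eq_zero_of_column_eq_zero j fun i => by simp [hj i])
  choose σ hσ using hex
  have hmono : StrictMono σ := fun i j hij => by
    by_contra! hle
    have := hx hij
    rw [hσ, hσ] at this
    exact absurd (hy.antitone hle) (by omega)
  have hid : ∀ j, σ j = j := fun j => by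
    have hiso : hmono.orderIsoOfSurjective σ
        (Finite.surjective_of_injective hmono.injective) = OrderIso.refl _ := Subsingleton.elim _ _
    exact congrArg (fun e : Fin d ≃o Fin d => e j) hiso
  exact h (funext fun j => by rw [hσ, hid])

/-- **Lindström–Gessel–Viennot with virtual points**: the determinant of functions evolving by
first-order difference equations, with one new function `v k * a k ^ z` entering at each level, is
the weighted sum over all configurations. -/
theorem det_eq_sum_weight (hy : StrictAnti y) {a : ℕ → ℝ} (ha : ∀ k, a k ≠ 0) (v : ℕ → ℝ)
    (ω : ℕ → ℤ → ℝ) (F : ℕ → ℕ → ℤ → ℝ)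
    (hF0 : ∀ (i : Fin d) z, F 0 i z = if z = y i then 1 else 0)
    (hF : ∀ k, ∀ i < d + k, ∀ z, F (k + 1) i z - a k * F (k + 1) i (z - 1) = ω k z * F k i z)
    (hv : ∀ (k : ℕ) z, -((d : ℤ) + k + 1) ≤ z → F (k + 1) (d + k) z = v k * a k ^ z) :
    ∀ {N : ℕ} {x : Fin (d + N) → ℤ} [Fintype (Config y x)], StrictAnti x →
      (∀ i, -((d : ℤ) + N) ≤ x i) →
      (Matrix.of fun i j : Fin (d + N) => F N i (x j)).det = ∑ c : Config y x, c.weight a v ω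
  | 0, x, inst, hx, _ => by
    have hmat : (Matrix.of fun i j : Fin (d + 0) => F 0 i (x j)) =
        Matrix.of fun i j : Fin d => if x j = y i then (1 : ℝ) else 0 := by
      ext i j
      exact hF0 i _
    rw [hmat]
    by_cases hxy : x = y
    · subst hxy
      refine (det_indicator_eq_one hx).trans ?_
      let c₀ : Config (N := 0) x x :=
        { row := fun k i => x ⟨i, by omega⟩
          strictAnti := fun k i j hij => hx hij
          interlace := fun k hk => absurd hk (Nat.not_lt_zero k)
          bottom := fun i => rfl
          top := fun i => rfl }
      have huniv : ∀ c : Config (N := 0) x x, c = c₀ := fun c => Config.ext_row fun k => by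
        obtain rfl : k = 0 := Subsingleton.elim (α := Fin 1) _ _
        rw [c.row_zero, c₀.row_zero]
      rw [Fintype.sum_eq_single c₀ fun c hc => absurd (huniv c) hc]
      simp [Config.weight]
    · refine (det_indicator_eq_zero hx hy hxy).trans ?_
      have : IsEmpty (Config (N := 0) y x) :=
        ⟨fun c => hxy (by rw [← c.row_zero]; exact c.row_last.symm)⟩
      simp
  | N + 1, x, inst, hx, hlow => by
    have hfin : ∀ x' : interlacers (n := d + N) x, Fintype (Config y x'.1) := fun x' =>
      have := Config.finite y (strictAnti_of_mem_interlacers hx x'.2)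
      Fintype.ofFinite _
    have hdet := det_bordered_eq_sum_interlacers (n := d + N) hx (ha N) (v N)
      (f := fun i w => ω N w * F N i w) (F := fun i => F (N + 1) i)
      (fun i w => hF N i i.2 w) (Matrix.of fun i j => F (N + 1) i (x j)) (fun i j => rfl)
      (fun j => hv N _ (by have := hlow j; push_cast at this; linarith))
    refine hdet.trans ?_
    rw [← (Config.extend_bijective (y := y) hx).sum_comp, Fintype.sum_sigma,
      ← Finset.sum_coe_sort]
    refine Finset.sum_congr rfl fun x' _ => ?_
    have hx' := x'.2
    have hcol : (Matrix.of fun i j : Fin (d + N) => ω N (x'.1 j) * F N i (x'.1 j)).det =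
        (∏ j, ω N (x'.1 j)) * (Matrix.of fun i j : Fin (d + N) => F N i (x'.1 j)).det := by
      rw [← Matrix.det_mul_row]
      rfl
    rw [hcol, det_eq_sum_weight hy ha v ω F hF0 hF hv (strictAnti_of_mem_interlacers hx hx'),
      Finset.mul_sum, Finset.mul_sum]
    · refine Finset.sum_congr rfl fun c _ => ?_
      rw [Config.weight_extend]
      exact (fun A B W => by ring : ∀ A B W : ℝ, A * (B * W) = W * (A * B)) _ _ _
    -- The strict half of the interlacing raises the lower bound by one at each level down, which
    -- keeps `hv` applicable.
    · intro i
      have h1 := (mem_interlacers.1 hx' i).1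
      have h2 := hlow i.succ
      push_cast at h2
      omega

/-! ### The Jacobi–Trudi formula for configurations -/

/-- The coefficient of `X ^ r` in a power series for `r : ℤ`; it vanishes for `r < 0`. -/
def intCoeff (p : PowerSeries ℝ) (r : ℤ) : ℝ := if 0 ≤ r then PowerSeries.coeff r.toNat p else 0

lemma intCoeff_natCast (p : PowerSeries ℝ) (n : ℕ) : intCoeff p n = PowerSeries.coeff n p := by
  simp [intCoeff]

lemma intCoeff_of_neg (p : PowerSeries ℝ) {r : ℤ} (hr : r < 0) : intCoeff p r = 0 := by
  simp [intCoeff, hr]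

lemma intCoeff_linear_mul (a : ℝ) (p : PowerSeries ℝ) (r : ℤ) :
    intCoeff ((1 - PowerSeries.C a * PowerSeries.X) * p) r =
      intCoeff p r - a * intCoeff p (r - 1) := by
  rcases lt_or_ge r 0 with hr | hr
  · simp [intCoeff_of_neg _ hr, intCoeff_of_neg _ (show r - 1 < 0 by omega)]
  · lift r to ℕ using hr
    rw [intCoeff_natCast, intCoeff_natCast, sub_mul, one_mul, mul_assoc, map_sub]
    cases r with
    | zero => simp [intCoeff]
    | succ r =>
      rw [show ((r + 1 : ℕ) : ℤ) - 1 = (r : ℤ) by push_cast; ring, intCoeff_natCast,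
        PowerSeries.coeff_C_mul, PowerSeries.coeff_succ_X_mul]

/-- Multiplication by a power series whose coefficients vanish beyond degree `m`. -/
lemma intCoeff_mul {Q : PowerSeries ℝ} {m : ℕ} (hQ : ∀ i, m < i → PowerSeries.coeff i Q = 0)
    (p : PowerSeries ℝ) (r : ℤ) :
    intCoeff (Q * p) r =
      ∑ l ∈ Finset.range (m + 1), PowerSeries.coeff (m - l) Q * intCoeff p (r - m + l) := by
  rw [← Finset.sum_range_reflect]
  have hterm : ∀ l ∈ Finset.range (m + 1),
      PowerSeries.coeff (m - (m + 1 - 1 - l)) Q * intCoeff p (r - m + (m + 1 - 1 - l : ℕ)) =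
        PowerSeries.coeff l Q * intCoeff p (r - l) := fun l hl => by
    have hl' : l ≤ m := Nat.lt_succ_iff.1 (Finset.mem_range.1 hl)
    rw [show m - (m + 1 - 1 - l) = l by omega,
      show r - m + (m + 1 - 1 - l : ℕ) = r - l by omega]
  rw [Finset.sum_congr rfl hterm]
  rcases lt_or_ge r 0 with hr | hr
  · rw [intCoeff_of_neg _ hr]
    exact (Finset.sum_eq_zero fun l _ => by rw [intCoeff_of_neg _ (by omega), mul_zero]).symm
  · lift r to ℕ using hr
    rw [intCoeff_natCast, PowerSeries.coeff_mul, Finset.Nat.sum_antidiagonal_eq_sum_range_succ_mk]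
    have h1 : ∑ k ∈ Finset.range (r + 1), PowerSeries.coeff k Q * PowerSeries.coeff (r - k) p =
        ∑ k ∈ Finset.range (r + 1), PowerSeries.coeff k Q * intCoeff p ((r : ℤ) - k) :=
      Finset.sum_congr rfl fun k hk => by
        have hk' := Nat.lt_succ_iff.1 (Finset.mem_range.1 hk)
        rw [← Nat.cast_sub hk', intCoeff_natCast]
    refine h1.trans ?_
    rcases le_total r m with h | h
    · refine Finset.sum_subset (Finset.range_mono (by omega)) fun k _ hk => ?_
      rw [intCoeff_of_neg _ (by simp at hk; omega), mul_zero]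
    · refine (Finset.sum_subset (Finset.range_mono (by omega)) fun k _ hk => ?_).symm
      rw [hQ k (by simp at hk; omega), zero_mul]

/-- `∏_{j ≤ t < k} (1 - a_t X)⁻¹`. -/
def geomProd (a : ℕ → ℝ) (j k : ℕ) : PowerSeries ℝ :=
  ∏ t ∈ Finset.Ico j k, (1 - PowerSeries.C (a t) * PowerSeries.X : PowerSeries ℝ)⁻¹

/-- `∏_{t < j} (1 - a_t X)`. -/
def linearProd (a : ℕ → ℝ) (j : ℕ) : PowerSeries ℝ :=
  ∏ t ∈ Finset.range j, (1 - PowerSeries.C (a t) * PowerSeries.X : PowerSeries ℝ)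

lemma linear_mul_inv (a : ℝ) : (1 - PowerSeries.C a * PowerSeries.X : PowerSeries ℝ) *
    (1 - PowerSeries.C a * PowerSeries.X : PowerSeries ℝ)⁻¹ = 1 :=
  PowerSeries.mul_inv_cancel _ (by simp)

lemma linear_mul_geomProd_succ (a : ℕ → ℝ) {j k : ℕ} (h : j ≤ k) :
    (1 - PowerSeries.C (a k) * PowerSeries.X) * geomProd a j (k + 1) = geomProd a j k := by
  rw [geomProd, Finset.prod_Ico_succ_top h, mul_left_comm, linear_mul_inv, mul_one, geomProd]

lemma linearProd_mul_geomProd (a : ℕ → ℝ) {j k : ℕ} (h : j ≤ k) :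
    linearProd a j * geomProd a 0 k = geomProd a j k := by
  rw [geomProd, ← Finset.prod_Ico_consecutive _ (Nat.zero_le j) h, linearProd,
    Finset.range_eq_Ico, ← mul_assoc, ← Finset.prod_mul_distrib, geomProd,
    Finset.prod_eq_one fun t _ => linear_mul_inv (a t), one_mul]

lemma coeff_linearProd_of_lt (a : ℕ → ℝ) (j : ℕ) : ∀ i, j < i →
    PowerSeries.coeff i (linearProd a j) = 0 := by
  induction j with
  | zero =>
    intro i hi
    simp [linearProd, PowerSeries.coeff_one, hi.ne']
  | succ j ih =>
    intro i hi
    obtain ⟨i, rfl⟩ : ∃ n, i = n + 1 := ⟨i - 1, by omega⟩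
    rw [linearProd, Finset.prod_range_succ, ← linearProd, mul_sub, mul_one, map_sub,
      ← mul_assoc, PowerSeries.coeff_succ_mul_X, PowerSeries.coeff_mul_C, ih _ (by omega),
      ih _ (by omega)]
    simp

lemma coeff_zero_linearProd (a : ℕ → ℝ) (j : ℕ) :
    PowerSeries.coeff 0 (linearProd a j) = 1 := by
  rw [PowerSeries.coeff_zero_eq_constantCoeff_apply, linearProd, map_prod]
  exact Finset.prod_eq_one fun t _ => by simp

lemma coeff_geom (a : ℝ) (n : ℕ) : PowerSeries.coeff n
    (1 - PowerSeries.C a * PowerSeries.X : PowerSeries ℝ)⁻¹ = a ^ n := by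
  have h : (PowerSeries.mk fun n => a ^ n) =
      (1 - PowerSeries.C a * PowerSeries.X : PowerSeries ℝ)⁻¹ := by
    rw [PowerSeries.eq_inv_iff_mul_eq_one (by simp)]
    ext n
    rw [mul_sub, mul_one, map_sub, ← mul_assoc]
    cases n with
    | zero => simp
    | succ n =>
      rw [PowerSeries.coeff_succ_mul_X, PowerSeries.coeff_mul_C, PowerSeries.coeff_mk,
        PowerSeries.coeff_mk, PowerSeries.coeff_one]
      simp [pow_succ]
  rw [← h, PowerSeries.coeff_mk]

lemma yExt_castAdd (y : Fin d → ℤ) (i : Fin d) : yExt N y (Fin.castAdd N i) = y i := by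
  simp [yExt]

lemma yExt_natAdd (y : Fin d → ℤ) (j : Fin N) :
    yExt N y (Fin.natAdd d j) = -((d : ℤ) + (j : ℤ) + 1) := by
  simp [yExt]

lemma h_eq_intCoeff (a : ℕ → ℝ) (r : ℤ) :
    h r (fun t : Fin N => a t) = intCoeff (geomProd a 0 N) r := by
  rw [h, intCoeff, geomProd, ← Finset.range_eq_Ico, Finset.prod_range]

/-- The rows evolving from `χ_i` and from the virtual points, normalised so as to be polynomial in
the `a_t`. -/
def hRow (a : ℕ → ℝ) (y : Fin d → ℤ) (k i : ℕ) (z : ℤ) : ℝ :=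
  if hi : i < d then intCoeff (geomProd a 0 k) (z - y ⟨i, hi⟩)
  else intCoeff (geomProd a (i - d) k) (z + i + 1)

/-- A virtual row starts at a later parameter, and `geomProd a j N = linearProd a j * geomProd a 0
N` for `j ≤ N`. It is thus a finite combination of the rows using all parameters, and the change of
rows is unitriangular because `linearProd` has constant coefficient 1. -/
lemma det_hRow (a : ℕ → ℝ) (y : Fin d → ℤ) (x : Fin (d + N) → ℤ) :
    (Matrix.of fun i j : Fin (d + N) => hRow a y N i (x j)).det =
      (Matrix.of fun i j : Fin (d + N) => h (x i - yExt N y j) (fun t : Fin N => a t)).det := by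
  let U : Matrix (Fin (d + N)) (Fin (d + N)) ℝ := Matrix.of fun i l =>
    if (i : ℕ) < d then (if i = l then 1 else 0)
    else if d ≤ (l : ℕ) ∧ (l : ℕ) ≤ i then PowerSeries.coeff (i - l) (linearProd a (i - d)) else 0
  have hU : U.det = 1 := by
    rw [Matrix.det_of_isLowerTriangular]
    · refine Finset.prod_eq_one fun i _ => ?_
      by_cases hi : (i : ℕ) < d
      · simp [U, hi]
      · simp [U, hi, not_lt.1 hi, coeff_zero_linearProd]
    · intro i l hil
      have hil' : i < l := hil
      by_cases hi : (i : ℕ) < d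
      · simp [U, hi, hil'.ne]
      · simp [U, hi, hil']
  have hmul : (Matrix.of fun i j : Fin (d + N) => hRow a y N i (x j)) =
      U * (Matrix.of fun i j : Fin (d + N) =>
        h (x i - yExt N y j) (fun t : Fin N => a t)).transpose := by
    ext i j
    simp only [Matrix.of_apply, Matrix.mul_apply, Matrix.transpose_apply, h_eq_intCoeff]
    induction i using Fin.addCases with
    | left i =>
      simp [U, hRow, yExt_castAdd]
    | right i =>
      have hi : ¬ (d + (i : ℕ) < d) := by omega
      rw [Fin.sum_univ_add]
      have hzero : ∀ l : Fin d, U (Fin.natAdd d i) (Fin.castAdd N l) = 0 := fun l => by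
        simp [U]
      have hval : ∀ l : Fin N, U (Fin.natAdd d i) (Fin.natAdd d l) =
          if (l : ℕ) ≤ i then PowerSeries.coeff (i - l : ℕ) (linearProd a i) else 0 := fun l => by
        simp [U, Nat.add_sub_add_left]
      simp only [hzero, hval, zero_mul, Finset.sum_const_zero, zero_add, yExt_natAdd, hRow,
        Fin.val_natAdd, hi, dite_false, Nat.add_sub_cancel_left]
      rw [← linearProd_mul_geomProd a i.2.le, intCoeff_mul (coeff_linearProd_of_lt a i),
        Fin.sum_univ_eq_sum_range (fun l => (if l ≤ (i : ℕ) then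
          PowerSeries.coeff (i - l : ℕ) (linearProd a i) else 0) *
            intCoeff (geomProd a 0 N) (x j - -((d : ℤ) + l + 1))) N]
      have hsub : Finset.range ((i : ℕ) + 1) ⊆ Finset.range N := Finset.range_mono i.2
      rw [← Finset.sum_subset hsub fun l _ hl => by
        rw [if_neg (by simp at hl; omega), zero_mul]]
      refine Finset.sum_congr rfl fun l hl => ?_
      rw [if_pos (by simp at hl; omega)]
      congr 2
      push_cast
      ring
  rw [hmul, Matrix.det_mul, hU, one_mul, Matrix.det_transpose]

/-- Level `k + 1` has one more part than level `k`; the correction is the index of that part. -/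
lemma Config.size_succ_sub {x : Fin (d + N) → ℤ} (c : Config y x) (k : Fin N) :
    c.size k.succ - c.size k.castSucc =
      (∑ i, c.row k.succ i - ∑ i, c.row k.castSucc i) + ((d + k + 1 : ℕ) : ℤ) := by
  simp only [Config.size, Config.nu, Finset.sum_add_distrib]
  have h : ∑ i : Fin (d + (k.succ : ℕ)), ((i : ℤ) + 1) =
      ∑ i : Fin (d + (k.castSucc : ℕ)), ((i : ℤ) + 1) + ((d + k + 1 : ℕ) : ℤ) := by
    refine (Fin.sum_univ_castSucc (n := d + k) fun i => ((i : ℤ) + 1)).trans ?_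
    simp
  simp only [Finset.sum_add_distrib] at h
  linarith

/-- The determinant of complete homogeneous symmetric polynomials as a sum over configurations. -/
theorem det_h_eq_sum (hy : StrictAnti y) {a : ℕ → ℝ} (ha : ∀ k, a k ≠ 0)
    {x : Fin (d + N) → ℤ} [Fintype (Config y x)] (hx : StrictAnti x)
    (hlow : ∀ i, -((d : ℤ) + N) ≤ x i) :
    (Matrix.of fun i j : Fin (d + N) => h (x i - yExt N y j) (fun t : Fin N => a t)).det =
      ∑ c : Config y x, ∏ k : Fin N, a k ^ (c.size k.succ - c.size k.castSucc) := by
  rw [← det_hRow, det_eq_sum_weight hy ha (fun k => a k ^ (d + k + 1)) (fun _ _ => 1) (hRow a y)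
    ?_ ?_ ?_ hx hlow]
  · refine Finset.sum_congr rfl fun c _ => Finset.prod_congr rfl fun k _ => ?_
    rw [c.size_succ_sub, zpow_add₀ (ha _), zpow_natCast]
    simp [mul_comm]
  · intro i z
    simp only [hRow, i.2, dite_true, geomProd, Finset.Ico_self, Finset.prod_empty]
    rcases lt_or_ge (z - y i) 0 with hz | hz
    · rw [intCoeff_of_neg _ hz, if_neg (by omega)]
    · obtain ⟨n, hn⟩ := Int.eq_ofNat_of_zero_le hz
      rw [hn, intCoeff_natCast, PowerSeries.coeff_one]
      congr 1
      simp only [eq_iff_iff]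
      omega
  · intro k i hi z
    rw [one_mul]
    by_cases hid : i < d
    · simp only [hRow, hid, dite_true]
      rw [← linear_mul_geomProd_succ a (Nat.zero_le k), intCoeff_linear_mul, sub_right_comm]
    · simp only [hRow, hid, dite_false]
      rw [← linear_mul_geomProd_succ a (show i - d ≤ k by omega), intCoeff_linear_mul]
      congr 3
      ring
  · intro k z hz
    simp only [hRow, show ¬ (d + k < d) by omega, dite_false, Nat.add_sub_cancel_left]
    -- In this range the degree is nonnegative and the coefficient of a single geometric series is a
    -- pure power. Further left it is zero, which is why `hv` is restricted.
    obtain ⟨n, hn⟩ := Int.eq_ofNat_of_zero_le (show 0 ≤ z + (d + k : ℕ) + 1 by push_cast; linarith)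
    rw [hn, intCoeff_natCast, geomProd, Nat.Ico_succ_singleton, Finset.prod_singleton, coeff_geom,
      ← zpow_natCast, ← zpow_natCast, ← zpow_add₀ (ha k)]
    congr 1
    push_cast at hn ⊢
    linarith

/-! ### The convolution kernels -/

lemma phi_coe (q : ℝ) (k : ℕ) (x z : ℤ) :
    phi q k (x : WithBot ℤ) z = if x ≤ z then q ^ (((k : ℤ) - 1) * (z - x)) else 0 := rfl

lemma phi_bot (q : ℝ) (k : ℕ) (z : ℤ) : phi q k ⊥ z = q ^ (((k : ℤ) - 1) * z) := rfl

lemma phiIter_of_lt (q : ℝ) (a l : ℕ) {x v : ℤ} (h : v < x) : phiIter q a l x v = 0 := by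
  induction l generalizing v with
  | zero => simp [phiIter, h.ne']
  | succ l ih =>
    rw [phiIter]
    refine (tsum_congr fun z => ?_).trans tsum_zero
    rcases lt_or_ge z x with hz | hz
    · rw [ih hz, zero_mul]
    · rw [phi_coe, if_neg (by omega), mul_zero]

lemma phiIter_succ (q : ℝ) (a l : ℕ) (x v : ℤ) :
    phiIter q a (l + 1) x v = ∑ z ∈ Finset.Icc x v,
      phiIter q a l x z * (q ^ (((a + l : ℕ) : ℤ) - 1)) ^ (v - z) := by
  rw [phiIter, tsum_eq_sum (s := Finset.Icc x v)]
  · refine Finset.sum_congr rfl fun z hz => ?_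
    rw [phi_coe, if_pos (Finset.mem_Icc.1 hz).2, zpow_mul]
  · intro z hz
    rcases lt_or_ge z x with h | h
    · rw [phiIter_of_lt _ _ _ h, zero_mul]
    · rw [phi_coe, if_neg fun h' => hz (Finset.mem_Icc.2 ⟨h, h'⟩), mul_zero]

/-- The first-order difference operator inverts convolution with the last factor, since that
convolution is a geometric sum. -/
lemma phiIter_succ_sub {q : ℝ} (hq : 0 < q) (a l : ℕ) (x v : ℤ) :
    phiIter q a (l + 1) x v - q ^ (((a + l : ℕ) : ℤ) - 1) * phiIter q a (l + 1) x (v - 1) =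
      phiIter q a l x v := by
  rcases lt_or_ge v x with h | h
  · rw [phiIter_of_lt _ _ _ h, phiIter_of_lt _ _ _ h, phiIter_of_lt _ _ _ (by omega)]
    simp
  · rw [phiIter_succ, phiIter_succ]
    have hins : Finset.Icc x v = insert v (Finset.Icc x (v - 1)) := by
      ext z
      simp only [Finset.mem_Icc, Finset.mem_insert]
      omega
    rw [hins, Finset.sum_insert (by simp), Finset.mul_sum, add_sub_assoc,
      ← Finset.sum_sub_distrib, Finset.sum_eq_zero, sub_self, zpow_zero, mul_one, add_zero]
    intro z _
    have hb : q ^ (((a + l : ℕ) : ℤ) - 1) ≠ 0 := (zpow_pos hq _).ne'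
    rw [show v - z = 1 + (v - 1 - z) by ring, zpow_add₀ hb, zpow_one]
    ring

lemma phiIter_nonneg {q : ℝ} (hq : 0 < q) (a l : ℕ) (x v : ℤ) : 0 ≤ phiIter q a l x v := by
  induction l generalizing v with
  | zero =>
    rw [phiIter]
    positivity
  | succ l ih =>
    rw [phiIter_succ]
    exact Finset.sum_nonneg fun z _ => mul_nonneg (ih z) (by positivity)

/-- As `q ≤ 1`, every factor is bounded by the slowest decaying one, the first; each convolution has
at most `v - x + 1` terms. -/
lemma phiIter_le {q : ℝ} (hq : 0 < q) (hq1 : q ≤ 1) (a l : ℕ) {x v : ℤ} (h : x ≤ v) :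
    phiIter q a l x v ≤ ((v - x + 1 : ℤ) : ℝ) ^ l * (q ^ ((a : ℤ) - 1)) ^ (v - x) := by
  induction l generalizing v with
  | zero =>
    rw [phiIter]
    split_ifs with hxv
    · simp [hxv]
    · positivity
  | succ l ih =>
    rw [phiIter_succ]
    have hle : ∀ z ∈ Finset.Icc x v,
        phiIter q a l x z * (q ^ (((a + l : ℕ) : ℤ) - 1)) ^ (v - z) ≤
          ((v - x + 1 : ℤ) : ℝ) ^ l * (q ^ ((a : ℤ) - 1)) ^ (v - x) := by
      intro z hz
      obtain ⟨hxz, hzv⟩ := Finset.mem_Icc.1 hz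
      have h1 : ((z - x + 1 : ℤ) : ℝ) ^ l ≤ ((v - x + 1 : ℤ) : ℝ) ^ l := by
        refine pow_le_pow_left₀ ?_ ?_ l
        · exact_mod_cast (by omega : 0 ≤ z - x + 1)
        · exact_mod_cast (by omega : z - x + 1 ≤ v - x + 1)
      have h2 : (q ^ (((a + l : ℕ) : ℤ) - 1)) ^ (v - z) ≤ (q ^ ((a : ℤ) - 1)) ^ (v - z) := by
        refine zpow_le_zpow_left₀ (by omega) (by positivity) ?_
        exact zpow_le_zpow_right_of_le_one₀ hq hq1 (by push_cast; omega)
      calc phiIter q a l x z * (q ^ (((a + l : ℕ) : ℤ) - 1)) ^ (v - z)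
          ≤ (((v - x + 1 : ℤ) : ℝ) ^ l * (q ^ ((a : ℤ) - 1)) ^ (z - x)) *
              (q ^ ((a : ℤ) - 1)) ^ (v - z) := by
            refine mul_le_mul ((ih hxz).trans ?_) h2 (by positivity) ?_
            · exact mul_le_mul_of_nonneg_right h1 (by positivity)
            · exact mul_nonneg (pow_nonneg (by exact_mod_cast (by omega : 0 ≤ v - x + 1)) l)
                (by positivity)
        _ = _ := by
            rw [mul_assoc, ← zpow_add₀ (zpow_pos hq _).ne']
            congr 2
            ring
    refine (Finset.sum_le_card_nsmul _ _ _ hle).trans (le_of_eq ?_)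
    have hcard : ((Finset.Icc x v).card : ℝ) = ((v - x + 1 : ℤ) : ℝ) := by
      rw [Int.card_Icc, ← Int.cast_natCast, Int.toNat_of_nonneg (by omega)]
      congr 1
      ring
    rw [nsmul_eq_mul, hcard, pow_succ]
    ring

lemma phiConv_self (q : ℝ) (a : ℕ) (x v : ℤ) : phiConv q a a x v = if x = v then 1 else 0 := by
  simp [phiConv, phiIter]

lemma phiConv_succ_sub {q : ℝ} (hq : 0 < q) {a b : ℕ} (hab : a ≤ b) (x v : ℤ) :
    phiConv q a (b + 1) x v - q ^ ((b : ℤ) - 1) * phiConv q a (b + 1) x (v - 1) =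
      phiConv q a b x v := by
  have h := phiIter_succ_sub hq a (b - a) x v
  rw [Nat.add_sub_cancel' hab] at h
  rwa [phiConv, phiConv, Nat.succ_sub hab]

/-- The virtual factor is `q ^ ((k - 1) * z)`, while the kernel, beginning at `k + 1`, is at most a
polynomial times `q ^ (k * (v - z))`. A decay `q ^ (v - z)` remains as `z → -∞`. -/
lemma summable_phi_bot_mul_phiConv {q : ℝ} (hq : 0 < q) (hq1 : q < 1) (k b : ℕ) (v : ℤ) :
    Summable fun z : ℤ => phi q k ⊥ z * phiConv q (k + 1) b z v := by
  have hinj : Function.Injective fun n : ℕ => v - n := fun m n h => by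
    simpa using h
  rw [← hinj.summable_iff]
  · set l := b - (k + 1)
    have hs : Summable fun n : ℕ =>
        (q ^ (((k : ℤ) - 1) * v) * q⁻¹) * (((n + 1 : ℕ) : ℝ) ^ l * q ^ (n + 1)) :=
      ((summable_nat_add_iff 1).2 (summable_pow_mul_geometric_of_norm_lt_one l
        (r := q) (by rwa [Real.norm_of_nonneg hq.le]))).mul_left _
    refine Summable.of_nonneg_of_le (fun n => ?_) (fun n => ?_) hs
    · exact mul_nonneg (by rw [phi_bot]; positivity) (phiIter_nonneg hq _ _ _ _)
    · have hle := phiIter_le hq hq1.le (k + 1) l (show v - (n : ℤ) ≤ v by omega)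
      refine (mul_le_mul_of_nonneg_left hle (by rw [phi_bot]; positivity)).trans (le_of_eq ?_)
      rw [phi_bot, mul_left_comm]
      have h1 : ((v - (v - (n : ℤ)) + 1 : ℤ) : ℝ) = ((n + 1 : ℕ) : ℝ) := by push_cast; ring
      rw [h1, ← zpow_mul, ← zpow_add₀ hq.ne', mul_left_comm (q ^ (((k : ℤ) - 1) * v) * q⁻¹)]
      congr 1
      rw [← zpow_neg_one, ← zpow_natCast q (n + 1), ← zpow_add₀ hq.ne', ← zpow_add₀ hq.ne']
      congr 1
      push_cast
      ring
  · intro z hz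
    have hzv : v < z := by
      by_contra! hle
      exact hz ⟨(v - z).toNat, by simp only; omega⟩
    rw [phiConv, phiIter_of_lt _ _ _ hzv, mul_zero]

/-- `φ_k(virt, ·) * φ^{k+1,b}`. -/
def virtRow (q : ℝ) (k b : ℕ) (v : ℤ) : ℝ := ∑' z : ℤ, phi q k ⊥ z * phiConv q (k + 1) b z v

lemma virtRow_self (q : ℝ) (k : ℕ) (v : ℤ) : virtRow q k (k + 1) v = q ^ (((k : ℤ) - 1) * v) := by
  rw [virtRow, tsum_eq_single v]
  · simp [phiConv_self, phi_bot]
  · intro z hz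
    simp [phiConv_self, hz]

lemma virtRow_succ_sub {q : ℝ} (hq : 0 < q) (hq1 : q < 1) {k b : ℕ} (hkb : k + 1 ≤ b) (v : ℤ) :
    virtRow q k (b + 1) v - q ^ ((b : ℤ) - 1) * virtRow q k (b + 1) (v - 1) = virtRow q k b v := by
  have hs := summable_phi_bot_mul_phiConv hq hq1 k (b + 1)
  rw [virtRow, virtRow, virtRow, ← tsum_mul_left, ← (hs v).tsum_sub ((hs (v - 1)).mul_left _)]
  refine tsum_congr fun z => ?_
  rw [← phiConv_succ_sub hq hkb]
  ring

/-! ### Evolution of the rows, unperturbed and perturbed at finitely many points -/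

/-- Row `i` at level `k`: it evolves from `χ_i` for `i < d`, and from the virtual point of level
`i - d + 1` for `i ≥ d`. -/
def baseRow (q : ℝ) (y : Fin d → ℤ) (k i : ℕ) (z : ℤ) : ℝ :=
  if hi : i < d then phiConv q (d + 1) (d + 1 + k) (y ⟨i, hi⟩) z
  else if i - d < k then virtRow q (i + 1) (d + 1 + k) z else 0

lemma baseRow_zero (q : ℝ) (y : Fin d → ℤ) (i : Fin d) (z : ℤ) :
    baseRow q y 0 i z = if z = y i then 1 else 0 := by
  simp [baseRow, phiConv_self, eq_comm]

lemma baseRow_succ_sub {q : ℝ} (hq : 0 < q) (hq1 : q < 1) (y : Fin d → ℤ) {k i : ℕ}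
    (hi : i < d + k) (z : ℤ) :
    baseRow q y (k + 1) i z - q ^ (d + k) * baseRow q y (k + 1) i (z - 1) = baseRow q y k i z := by
  have hpow : q ^ (d + k) = q ^ (((d + 1 + k : ℕ) : ℤ) - 1) := by
    rw [← zpow_natCast]
    congr 1
    push_cast
    ring
  rw [hpow]
  by_cases hid : i < d
  · simp only [baseRow, hid, dite_true]
    exact phiConv_succ_sub hq (show d + 1 ≤ d + 1 + k by omega) _ _
  · have h1 : i - d < k + 1 := by omega
    have h2 : i - d < k := by omega
    simp only [baseRow, hid, dite_false, h1, h2, if_true]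
    exact virtRow_succ_sub hq hq1 (show i + 1 + 1 ≤ d + 1 + k by omega) _

lemma baseRow_virt (q : ℝ) (y : Fin d → ℤ) (k : ℕ) (z : ℤ) :
    baseRow q y (k + 1) (d + k) z = (q ^ (d + k)) ^ z := by
  have h := virtRow_self q (d + k + 1) z
  simp only [baseRow, show ¬ (d + k < d) by omega, dite_false, show d + k - d < k + 1 by omega,
    if_true, show d + 1 + (k + 1) = d + k + 1 + 1 by omega, h]
  rw [← zpow_natCast, ← zpow_mul]
  congr 1
  push_cast
  ring

variable {r : ℕ}

/-- The kernel `1_{m < n} φ_{d+m+1} * ⋯ * φ_{d+n}` at given points. -/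
def stepMatrix (q : ℝ) (d : ℕ) (p : Fin r → Fin (N + 1) × ℤ) : Matrix (Fin r) (Fin r) ℝ :=
  Matrix.of fun s s' => if ((p s).1 : ℕ) < (p s').1 then
    phiConv q (d + (p s).1 + 1) (d + (p s').1 + 1) (p s).2 (p s').2 else 0

/-- Transitions strictly raise the level, so the step matrix is strictly block triangular with
respect to levels. -/
lemma det_one_sub_smul_stepMatrix (q : ℝ) (d : ℕ) (p : Fin r → Fin (N + 1) × ℤ) (t : ℝ) :
    (1 - t • stepMatrix q d p).det = 1 := by
  have htri : (1 - t • stepMatrix q d p).BlockTriangular fun s => (p s).1 := by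
    intro s s' h
    have hne : s ≠ s' := by rintro rfl; exact lt_irrefl _ h
    have h' : ¬ (p s).1 < (p s').1 := not_lt.2 (le_of_lt h)
    simp [stepMatrix, hne, h']
  rw [htri.det_fintype]
  refine Finset.prod_eq_one fun k _ => ?_
  rw [← Matrix.det_one (n := {s // (p s).1 = k})]
  congr 1
  ext s s'
  simp [Matrix.toSquareBlock, Matrix.toSquareBlockProp, stepMatrix, s.2, s'.2, Matrix.one_apply,
    Subtype.ext_iff]

/-- The values of row `i` of the perturbed system at the points `p`. -/
def pertValue (q : ℝ) (y : Fin d → ℤ) (p : Fin r → Fin (N + 1) × ℤ) (t : ℝ) (i : ℕ) : Fin r → ℝ :=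
  Matrix.vecMul (fun s => baseRow q y (p s).1 i (p s).2) (1 - t • stepMatrix q d p)⁻¹

/-- Row `i` at level `k` of the system perturbed by the weight `1 + t` at each of the points `p`. -/
def pertRow (q : ℝ) (y : Fin d → ℤ) (p : Fin r → Fin (N + 1) × ℤ) (t : ℝ) (k i : ℕ) (z : ℤ) : ℝ :=
  baseRow q y k i z + t * ∑ s, pertValue q y p t i s *
    if ((p s).1 : ℕ) < k then phiConv q (d + (p s).1 + 1) (d + k + 1) (p s).2 z else 0

/-- The weight of a dot at level `k` and position `z`: `1 + t` at the points `p`, else `1`. -/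
def pointWeight (p : Fin r → Fin (N + 1) × ℤ) (t : ℝ) (k : ℕ) (z : ℤ) : ℝ :=
  1 + t * ∑ s, if ((p s).1 : ℕ) = k ∧ (p s).2 = z then 1 else 0

/-- The perturbed rows depend on their own values at the points, a linear system with matrix `1 - t
• stepMatrix q d p`. Its solution is `pertValue`, so the definition of `pertRow` is self-consistent.
-/
lemma pertValue_eq_pertRow (q : ℝ) (y : Fin d → ℤ) (p : Fin r → Fin (N + 1) × ℤ) (t : ℝ) (i : ℕ)
    (s : Fin r) : pertValue q y p t i s = pertRow q y p t (p s).1 i (p s).2 := by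
  have hdet : IsUnit (1 - t • stepMatrix q d p).det := by
    rw [det_one_sub_smul_stepMatrix]
    exact isUnit_one
  have h : Matrix.vecMul (pertValue q y p t i) (1 - t • stepMatrix q d p) =
      fun s => baseRow q y (p s).1 i (p s).2 := by
    rw [pertValue, Matrix.vecMul_vecMul, Matrix.nonsing_inv_mul _ hdet, Matrix.vecMul_one]
  rw [Matrix.vecMul_sub, Matrix.vecMul_one, Matrix.vecMul_smul] at h
  have hs := congrFun h s
  simp only [Pi.sub_apply, Pi.smul_apply, smul_eq_mul, Matrix.vecMul, dotProduct, stepMatrix,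
    Matrix.of_apply] at hs
  rw [pertRow]
  linarith

/-- The unperturbed row is zero up to level `k`, and corrections come only from values at strictly
lower points; induct on the level. -/
lemma pertValue_virt (q : ℝ) (y : Fin d → ℤ) (p : Fin r → Fin (N + 1) × ℤ) (t : ℝ) (k : ℕ)
    (s : Fin r) (hs : ((p s).1 : ℕ) ≤ k) : pertValue q y p t (d + k) s = 0 := by
  induction hm : ((p s).1 : ℕ) using Nat.strong_induction_on generalizing s with
  | _ m ih =>
    rw [pertValue_eq_pertRow, pertRow, Finset.sum_eq_zero]
    · simp [baseRow, hs]
    · intro s' _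
      split_ifs with h
      · rw [ih _ (hm ▸ h) s' (by omega) rfl, zero_mul]
      · rw [mul_zero]

/-- Points of level exactly `k` act through the identity kernel, so the weight merely turns `<` into
`≤`. -/
lemma pointWeight_mul_pertRow (q : ℝ) (y : Fin d → ℤ) (p : Fin r → Fin (N + 1) × ℤ) (t : ℝ)
    (k i : ℕ) (z : ℤ) :
    pointWeight p t k z * pertRow q y p t k i z =
      baseRow q y k i z + t * ∑ s, pertValue q y p t i s *
        if ((p s).1 : ℕ) ≤ k then phiConv q (d + (p s).1 + 1) (d + k + 1) (p s).2 z else 0 := by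
  have hsplit : ∀ s, (pertValue q y p t i s *
      if ((p s).1 : ℕ) ≤ k then phiConv q (d + (p s).1 + 1) (d + k + 1) (p s).2 z else 0) =
      (pertValue q y p t i s *
        if ((p s).1 : ℕ) < k then phiConv q (d + (p s).1 + 1) (d + k + 1) (p s).2 z else 0) +
      (if ((p s).1 : ℕ) = k ∧ (p s).2 = z then 1 else 0) * pertRow q y p t k i z := by
    intro s
    rcases lt_trichotomy ((p s).1 : ℕ) k with h | h | h
    · simp [h, h.le, h.ne]
    · rw [if_pos h.le, if_neg (by omega), mul_zero, zero_add, h, phiConv_self]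
      by_cases hz : (p s).2 = z
      · rw [if_pos hz, if_pos ⟨rfl, hz⟩, pertValue_eq_pertRow, h, hz, mul_one, one_mul]
      · simp [hz]
    · simp [h.not_ge, h.not_gt, h.ne']
  rw [Finset.sum_congr rfl fun s _ => hsplit s, Finset.sum_add_distrib, ← Finset.sum_mul, mul_add,
    ← add_assoc, ← pertRow, pointWeight]
  ring

lemma pertRow_zero (q : ℝ) (y : Fin d → ℤ) (p : Fin r → Fin (N + 1) × ℤ) (t : ℝ) (i : Fin d)
    (z : ℤ) : pertRow q y p t 0 i z = if z = y i then 1 else 0 := by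
  simp [pertRow, baseRow_zero]

/-- The condition `≤ k` left by the weight is `< k + 1` one level higher, and each transition kernel
satisfies its own difference equation. -/
lemma pertRow_succ_sub {q : ℝ} (hq : 0 < q) (hq1 : q < 1) (y : Fin d → ℤ)
    (p : Fin r → Fin (N + 1) × ℤ) (t : ℝ) {k i : ℕ} (hi : i < d + k) (z : ℤ) :
    pertRow q y p t (k + 1) i z - q ^ (d + k) * pertRow q y p t (k + 1) i (z - 1) =
      pointWeight p t k z * pertRow q y p t k i z := by
  rw [pointWeight_mul_pertRow, ← baseRow_succ_sub hq hq1 y hi, pertRow, pertRow]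
  have hterm : ∀ s, (if ((p s).1 : ℕ) ≤ k then
      phiConv q (d + (p s).1 + 1) (d + k + 1) (p s).2 z else 0) =
      (if ((p s).1 : ℕ) < k + 1 then
        phiConv q (d + (p s).1 + 1) (d + (k + 1) + 1) (p s).2 z else 0) -
      q ^ (d + k) * (if ((p s).1 : ℕ) < k + 1 then
        phiConv q (d + (p s).1 + 1) (d + (k + 1) + 1) (p s).2 (z - 1) else 0) := by
    intro s
    by_cases h : ((p s).1 : ℕ) ≤ k
    · rw [if_pos h, if_pos (Nat.lt_succ_of_le h), if_pos (Nat.lt_succ_of_le h),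
        ← phiConv_succ_sub hq (show d + (p s).1 + 1 ≤ d + k + 1 by omega)]
      have hpow : q ^ (d + k) = q ^ (((d + k + 1 : ℕ) : ℤ) - 1) := by
        rw [← zpow_natCast]
        congr 1
        push_cast
        ring
      rw [hpow]
      rfl
    · simp [h]
  simp_rw [hterm, mul_sub, Finset.sum_sub_distrib, mul_left_comm _ (q ^ (d + k)),
    ← Finset.mul_sum]
  ring

lemma pertRow_virt (q : ℝ) (y : Fin d → ℤ) (p : Fin r → Fin (N + 1) × ℤ) (t : ℝ) (k : ℕ) (z : ℤ) :
    pertRow q y p t (k + 1) (d + k) z = (q ^ (d + k)) ^ z := by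
  rw [pertRow, baseRow_virt, Finset.sum_eq_zero, mul_zero, add_zero]
  intro s _
  split_ifs with h
  · rw [pertValue_virt _ _ _ _ _ _ (Nat.lt_succ_iff.1 h), zero_mul]
  · rw [mul_zero]

/-! ### The matrix form of the kernel -/

lemma isUnit_det_inv_transpose {n : Type*} [Fintype n] [DecidableEq n] {A : Matrix n n ℝ}
    (hA : IsUnit A.det) : IsUnit (A⁻¹.transpose).det := by
  rw [Matrix.det_transpose]
  exact Matrix.isUnit_nonsing_inv_det A hA

/-- The values of the rows at the prescribed top level. -/
def topMatrix (q : ℝ) (y : Fin d → ℤ) (x : Fin (d + N) → ℤ) :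
    Matrix (Fin (d + N)) (Fin (d + N)) ℝ :=
  Matrix.of fun i j => baseRow q y N i (x j)

/-- The transition kernels from given points to the top level. -/
def toTopMatrix (q : ℝ) (x : Fin (d + N) → ℤ) (p : Fin r → Fin (N + 1) × ℤ) :
    Matrix (Fin r) (Fin (d + N)) ℝ :=
  Matrix.of fun s j => phiConv q (d + (p s).1 + 1) (d + N + 1) (p s).2 (x j)

/-- The values of the rows at given points. -/
def rowMatrix (q : ℝ) (y : Fin d → ℤ) (p : Fin r → Fin (N + 1) × ℤ) :
    Matrix (Fin (d + N)) (Fin r) ℝ :=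
  Matrix.of fun i s => baseRow q y (p s).1 i (p s).2

lemma psiLevel_eq_sum (q : ℝ) (y : Fin d → ℤ) (x : Fin (d + N) → ℤ) (m : ℕ) (k : Fin (d + N))
    (u : ℤ) :
    psiLevel q y x m k u =
      ∑ j, phiConv q (d + m + 1) (d + N + 1) u (x j) * (H q y x)⁻¹ k j := by
  have hterm : ∀ z, phiConv q (d + m + 1) (d + N + 1) u z * psi q y x k z =
      ∑ j, if z = x j then phiConv q (d + m + 1) (d + N + 1) u (x j) * (H q y x)⁻¹ k j else 0 := by
    intro z
    rw [psi, Finset.mul_sum]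
    refine Finset.sum_congr rfl fun j _ => ?_
    split_ifs with h <;> simp [h]
  simp_rw [psiLevel, hterm]
  exact (hasSum_sum fun j _ => hasSum_ite_eq (x j) _).tsum_eq

lemma tsum_chi_mul (y : Fin d → ℤ) (i : Fin d) (f : ℤ → ℝ) : ∑' z, chi y i z * f z = f (y i) := by
  rw [tsum_eq_single (y i)]
  · simp [chi]
  · intro z hz
    simp [chi, hz]

lemma hasSum_phi_bot_mul_psiLevel {q : ℝ} (hq : 0 < q) (hq1 : q < 1) (y : Fin d → ℤ)
    (x : Fin (d + N) → ℤ) (j : Fin N) (l : Fin (d + N)) :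
    HasSum (fun z : ℤ => phi q (d + (j + 1)) ⊥ z * psiLevel q y x (j + 1) l z)
      (∑ i, virtRow q (d + (j + 1)) (d + N + 1) (x i) * (H q y x)⁻¹ l i) := by
  have hterm : ∀ z, phi q (d + (j + 1)) ⊥ z * psiLevel q y x (j + 1) l z =
      ∑ i, phi q (d + (j + 1)) ⊥ z * phiConv q (d + (j + 1) + 1) (d + N + 1) z (x i) *
        (H q y x)⁻¹ l i := fun z => by
    rw [psiLevel_eq_sum, Finset.mul_sum]
    exact Finset.sum_congr rfl fun i _ => (mul_assoc _ _ _).symm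
  simp_rw [hterm]
  exact hasSum_sum fun i _ => (summable_phi_bot_mul_phiConv hq hq1 _ _ _).hasSum.mul_right _

/-- Each `ψ_ℓ` is supported on the top points with coefficients from `H⁻¹`, which therefore factors
out on the right. -/
lemma M_eq_topMatrix_mul {q : ℝ} (hq : 0 < q) (hq1 : q < 1) (y : Fin d → ℤ)
    (x : Fin (d + N) → ℤ) : M q y x = topMatrix q y x * (H q y x)⁻¹.transpose := by
  ext k l
  rw [Matrix.mul_apply]
  induction k using Fin.addCases with
  | left i =>
    simp only [M, Matrix.of_apply, Fin.addCases_left, tsum_chi_mul, psiLevel_eq_sum, topMatrix,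
      baseRow, Fin.val_castAdd, i.2, dite_true, Matrix.transpose_apply,
      Nat.add_right_comm d 1 N, add_zero]
  | right j =>
    simp only [M, Matrix.of_apply, Fin.addCases_right, topMatrix, baseRow, Fin.val_natAdd,
      show ¬ (d + (j : ℕ) < d) by omega, dite_false, Nat.add_sub_cancel_left, j.2, if_true,
      Matrix.transpose_apply, Nat.add_right_comm d 1 N]
    exact (hasSum_phi_bot_mul_psiLevel hq hq1 y x j l).tsum_eq

lemma kernelMatrix_eq {q : ℝ} (hq : 0 < q) (hq1 : q < 1) {x : Fin (d + N) → ℤ}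
    (hH : IsUnit (H q y x).det) (p : Fin r → Fin (N + 1) × ℤ) :
    (Matrix.of fun s s' => kernel q y x (p s).1 (p s).2 (p s').1 (p s').2) =
      toTopMatrix q x p * (topMatrix q y x)⁻¹ * rowMatrix q y p - stepMatrix q d p := by
  set Ψ : Matrix (Fin r) (Fin (d + N)) ℝ :=
    Matrix.of fun s k => psiLevel q y x (p s).1 k (p s).2 with hΨ
  have hΨC : Ψ = toTopMatrix q x p * (H q y x)⁻¹.transpose := by
    ext s k
    simp [hΨ, toTopMatrix, psiLevel_eq_sum, Matrix.mul_apply]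
  -- The factor `H⁻ᵀ` of `Ψ` cancels against that of `M`.
  have hmain : toTopMatrix q x p * (topMatrix q y x)⁻¹ = Ψ * (M q y x)⁻¹ := by
    rw [M_eq_topMatrix_mul hq hq1, Matrix.mul_inv_rev, hΨC, Matrix.mul_assoc (toTopMatrix q x p),
      ← Matrix.mul_assoc _ _ (topMatrix q y x)⁻¹,
      Matrix.mul_nonsing_inv _ (isUnit_det_inv_transpose hH), Matrix.one_mul]
  rw [hmain]
  ext s s'
  have h0 : (Ψ * (M q y x)⁻¹ * rowMatrix q y p) s s' =
      ∑ l : Fin d, ∑ k, Ψ s k * (M q y x)⁻¹ k (Fin.castAdd N l) *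
        rowMatrix q y p (Fin.castAdd N l) s' +
      ∑ j : Fin N, ∑ k, Ψ s k * (M q y x)⁻¹ k (Fin.natAdd d j) *
        rowMatrix q y p (Fin.natAdd d j) s' := by
    simp only [Matrix.mul_apply, Finset.sum_mul]
    rw [Fin.sum_univ_add]
  have h1 : ∑ l : Fin d, ∑ k, Ψ s k * (M q y x)⁻¹ k (Fin.castAdd N l) *
      rowMatrix q y p (Fin.castAdd N l) s' = ∑ k, ∑ l : Fin d,
        psiLevel q y x (p s).1 k (p s).2 * (M q y x)⁻¹ k (Fin.castAdd N l) *
          phiConv q (d + 1) (d + 1 + (p s').1) (y l) (p s').2 := by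
    rw [Finset.sum_comm]
    simp [hΨ, rowMatrix, baseRow]
  have h2 : ∑ j : Fin N, ∑ k, Ψ s k * (M q y x)⁻¹ k (Fin.natAdd d j) *
      rowMatrix q y p (Fin.natAdd d j) s' =
      ∑ k, ∑ j ∈ Finset.univ.filter (fun j : Fin N => (j : ℕ) < (p s').1),
        psiLevel q y x (p s).1 k (p s).2 * (M q y x)⁻¹ k (Fin.natAdd d j) *
          virtRow q (d + (j + 1)) (d + 1 + (p s').1) (p s').2 := by
    rw [Finset.sum_comm]
    refine Finset.sum_congr rfl fun k _ => ?_
    rw [Finset.sum_filter]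
    refine Finset.sum_congr rfl fun j _ => ?_
    -- Rows whose virtual point enters above the level of `p s'` vanish there, whence the cut-off `j
    -- < n` in the kernel.
    by_cases hj : (j : ℕ) < (p s').1
    · simp [hΨ, rowMatrix, baseRow, hj, add_assoc]
    · simp [hΨ, rowMatrix, baseRow, hj]
  rw [Matrix.sub_apply, h0, h1, h2]
  simp only [stepMatrix, Matrix.of_apply, virtRow, kernel, tsum_chi_mul]
  ring

/-! ### Generating functions -/

/-- The weight of a configuration without distinguished points. -/
abbrev Config.plainWeight (q : ℝ) {x : Fin (d + N) → ℤ} (c : Config y x) : ℝ :=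
  c.weight (fun k => q ^ (d + k)) (fun _ => 1) (fun _ _ => 1)

lemma det_topMatrix {q : ℝ} (hq : 0 < q) (hq1 : q < 1) (hy : StrictAnti y)
    {x : Fin (d + N) → ℤ} [Fintype (Config y x)] (hx : StrictAnti x)
    (hlow : ∀ i, -((d : ℤ) + N) ≤ x i) :
    (topMatrix q y x).det = ∑ c : Config y x, c.plainWeight q :=
  det_eq_sum_weight hy (fun k => (pow_pos hq _).ne') _ _ (baseRow q y) (baseRow_zero q y)
    (fun k i hi z => by rw [one_mul]; exact baseRow_succ_sub hq hq1 y hi z)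
    (fun k z _ => by rw [one_mul]; exact baseRow_virt q y k z) hx hlow

/-- The points being distinct, at most one indicator is nonzero, so the sum and the product agree.
-/
lemma pointWeight_eq_prod {p : Fin r → Fin (N + 1) × ℤ} (hp : Function.Injective p) (t : ℝ)
    (k : ℕ) (z : ℤ) :
    pointWeight p t k z = ∏ s, if ((p s).1 : ℕ) = k ∧ (p s).2 = z then 1 + t else 1 := by
  rw [pointWeight]
  by_cases h : ∃ s, ((p s).1 : ℕ) = k ∧ (p s).2 = z
  · obtain ⟨s, hs⟩ := h
    have hne : ∀ s', s' ≠ s → ¬ (((p s').1 : ℕ) = k ∧ (p s').2 = z) := fun s' hs' h' =>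
      hs' (hp (Prod.ext (Fin.ext (h'.1.trans hs.1.symm)) (h'.2.trans hs.2.symm)))
    rw [Fintype.sum_eq_single s fun s' hs' => if_neg (hne s' hs'),
      Fintype.prod_eq_single s fun s' hs' => if_neg (hne s' hs'), if_pos hs, if_pos hs, mul_one]
  · push Not at h
    rw [Finset.sum_eq_zero fun s _ => if_neg fun hs => h s hs.1 hs.2,
      Finset.prod_eq_one fun s _ => if_neg fun hs => h s hs.1 hs.2, mul_zero, add_zero]

open Classical in
lemma Config.prod_pointWeight {x : Fin (d + N) → ℤ} (c : Config y x)
    {p : Fin r → Fin (N + 1) × ℤ} (hp : Function.Injective p) (t : ℝ) :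
    ∏ k : Fin (N + 1), ∏ i, pointWeight p t k (c.row k i) =
      ∏ s, if p s ∈ c.dots then 1 + t else 1 := by
  simp_rw [pointWeight_eq_prod hp]
  rw [Finset.prod_congr rfl fun k _ => Finset.prod_comm, Finset.prod_comm]
  refine Finset.prod_congr rfl fun s _ => ?_
  rw [Fintype.prod_eq_single (p s).1 fun k hk => Finset.prod_eq_one fun i _ =>
    if_neg fun h => hk (Fin.ext h.1.symm)]
  by_cases h : p s ∈ c.dots
  · obtain ⟨i, hi⟩ := h
    rw [Fintype.prod_eq_single i, if_pos ⟨rfl, hi.symm⟩, if_pos ⟨i, hi⟩]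
    exact fun i' hi' => if_neg fun h =>
      hi' ((c.strictAnti _).injective (h.2.symm.trans hi.symm))
  · rw [if_neg h]
    exact Finset.prod_eq_one fun i _ => if_neg fun h' => h ⟨i, h'.2.symm⟩

open Classical in
lemma Config.weight_mul_prod {x : Fin (d + N) → ℤ} (c : Config y x) (q : ℝ)
    {p : Fin r → Fin (N + 1) × ℤ} (hp : Function.Injective p) (t : ℝ) :
    c.weight (fun k => q ^ (d + k)) (fun _ => 1) (pointWeight p t) *
        ∏ j, pointWeight p t N (x j) =
      c.plainWeight q * ∏ s, if p s ∈ c.dots then 1 + t else 1 := by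
  rw [← c.prod_pointWeight hp, Fin.prod_univ_castSucc, ← mul_assoc, c.row_last,
    Config.plainWeight, Config.weight, Config.weight, ← Finset.prod_mul_distrib]
  congr 1
  refine Finset.prod_congr rfl fun k _ => ?_
  simp

open Classical in
/-- The generating function of the number of given points covered by the dots. -/
lemma sum_weight_eq_det_one_add {q : ℝ} (hq : 0 < q) (hq1 : q < 1) (hy : StrictAnti y)
    {x : Fin (d + N) → ℤ} [Fintype (Config y x)] (hx : StrictAnti x)
    (hlow : ∀ i, -((d : ℤ) + N) ≤ x i) (hG : IsUnit (topMatrix q y x).det)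
    {p : Fin r → Fin (N + 1) × ℤ} (hp : Function.Injective p) (t : ℝ) :
    ∑ c : Config y x, c.plainWeight q * ∏ s, (if p s ∈ c.dots then 1 + t else 1) =
      (topMatrix q y x).det * (1 + t • (toTopMatrix q x p * (topMatrix q y x)⁻¹ *
        rowMatrix q y p - stepMatrix q d p)).det := by
  set G := topMatrix q y x
  set C := toTopMatrix q x p
  set R := rowMatrix q y p
  set S := 1 - t • stepMatrix q d p with hS
  have hSdet : S.det = 1 := det_one_sub_smul_stepMatrix q d p t
  have hSunit : IsUnit S.det := by rw [hSdet]; exact isUnit_one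
  -- `Config.weight` omits the dots of the top level; their weights enter here as column factors,
  -- after which every point contributes.
  have hpert : (Matrix.of fun i j : Fin (d + N) =>
      pointWeight p t N (x j) * pertRow q y p t N i (x j)) = G + t • (R * S⁻¹ * C) := by
    ext i j
    simp only [Matrix.of_apply, pointWeight_mul_pertRow, Matrix.add_apply, Matrix.smul_apply,
      smul_eq_mul]
    congr 2
    rw [Matrix.mul_apply]
    refine Finset.sum_congr rfl fun s _ => ?_
    rw [if_pos (Nat.lt_succ_iff.1 (p s).1.2)]
    rfl
  have hleft : ∑ c : Config y x, c.plainWeight q * ∏ s, (if p s ∈ c.dots then 1 + t else 1) =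
      (G + t • (R * S⁻¹ * C)).det := by
    rw [← hpert]
    refine Eq.trans ?_ (Matrix.det_mul_row (fun j => pointWeight p t N (x j))
      (Matrix.of fun i j : Fin (d + N) => pertRow q y p t N i (x j))).symm
    rw [det_eq_sum_weight hy (fun k => (pow_pos hq _).ne') (fun _ => 1) (pointWeight p t)
      (pertRow q y p t) (pertRow_zero q y p t)
      (fun k i hi z => pertRow_succ_sub hq hq1 y p t hi z)
      (fun k z _ => by rw [one_mul]; exact pertRow_virt q y p t k z) hx hlow, Finset.mul_sum]
    exact Finset.sum_congr rfl fun c _ => by rw [← c.weight_mul_prod q hp, mul_comm]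
  have hfac : G + t • (R * S⁻¹ * C) = G * (1 + (G⁻¹ * R) * (t • (S⁻¹ * C))) := by
    rw [Matrix.mul_add, Matrix.mul_one, ← Matrix.mul_assoc,
      Matrix.mul_nonsing_inv_cancel_left _ _ hG, Matrix.mul_smul, Matrix.mul_assoc]
  -- Multiplying by `S`, of determinant 1, clears `S⁻¹` and produces the term `-stepMatrix` of the
  -- kernel.
  have hS' : S * (1 + t • (S⁻¹ * C) * (G⁻¹ * R)) =
      1 + t • (C * G⁻¹ * R - stepMatrix q d p) := by
    rw [Matrix.mul_add, Matrix.mul_one, Matrix.smul_mul, Matrix.mul_smul, Matrix.mul_assoc S⁻¹,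
      Matrix.mul_nonsing_inv_cancel_left _ _ hSunit, ← Matrix.mul_assoc C, smul_sub, hS]
    abel
  rw [hleft, hfac, Matrix.det_mul, Matrix.det_one_add_mul_comm, ← hS', Matrix.det_mul, hSdet,
    one_mul]

open Classical in
/-- The weight of the configurations whose dots cover given points. -/
theorem sum_weight_covering {q : ℝ} (hq : 0 < q) (hq1 : q < 1) (hy : StrictAnti y)
    {x : Fin (d + N) → ℤ} [Fintype (Config y x)] (hx : StrictAnti x)
    (hlow : ∀ i, -((d : ℤ) + N) ≤ x i) (hG : IsUnit (topMatrix q y x).det)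
    {p : Fin r → Fin (N + 1) × ℤ} (hp : Function.Injective p) :
    ∑ c : Config y x, c.plainWeight q * (if ∀ s, p s ∈ c.dots then 1 else 0) =
      (topMatrix q y x).det * (toTopMatrix q x p * (topMatrix q y x)⁻¹ *
        rowMatrix q y p - stepMatrix q d p).det := by
  set K := toTopMatrix q x p * (topMatrix q y x)⁻¹ * rowMatrix q y p - stepMatrix q d p
  -- With `t = u⁻¹` and both sides multiplied by `u ^ r`, the identity extends by continuity to `u =
  -- 0`, where only the coefficient of `t ^ r` survives.
  have heq : (fun u : ℝ => ∑ c : Config y x,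
      c.plainWeight q * ∏ s, (if p s ∈ c.dots then u + 1 else u)) =
      fun u : ℝ => (topMatrix q y x).det * (u • (1 : Matrix (Fin r) (Fin r) ℝ) + K).det := by
    refine Continuous.ext_on (dense_compl_singleton (0 : ℝ)) ?_ ?_ fun u hu => ?_
    · refine continuous_finsetSum _ fun c _ => continuous_const.mul
        (continuous_finsetProd _ fun s _ => ?_)
      split_ifs <;> fun_prop
    · exact continuous_const.mul (Continuous.matrix_det (by fun_prop))
    · have hu' : u ≠ 0 := hu
      have h := sum_weight_eq_det_one_add hq hq1 hy hx hlow hG hp u⁻¹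
      have hdet : (u • (1 : Matrix (Fin r) (Fin r) ℝ) + K).det =
          u ^ r * (1 + u⁻¹ • K).det := by
        have := Matrix.det_smul (1 + u⁻¹ • K) u
        rwa [smul_add, smul_smul, mul_inv_cancel₀ hu', one_smul, Fintype.card_fin] at this
      rw [hdet, mul_left_comm, ← h, Finset.mul_sum]
      refine Finset.sum_congr rfl fun c _ => ?_
      rw [mul_left_comm]
      congr 1
      have hcard : u ^ r = ∏ _s : Fin r, u := by simp
      rw [hcard, ← Finset.prod_mul_distrib]
      refine Finset.prod_congr rfl fun s _ => ?_
      split_ifs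
      · rw [mul_add, mul_one, mul_inv_cancel₀ hu']
      · rw [mul_one]
  have h0 := congrFun heq 0
  simp only [zero_add, zero_smul] at h0
  rw [← h0]
  refine Finset.sum_congr rfl fun c _ => ?_
  congr 1
  rw [Finset.prod_ite_zero]
  simp

/-! ### The measure -/

/-- Summation by parts for the exponents of the `q`-weight. -/
lemma sum_mul_sub_eq (hN : 1 ≤ N) (S : Fin (N + 1) → ℤ) :
    ∑ k : Fin N, (1 - (N : ℤ) + k) * (S k.succ - S k.castSucc) =
      -((∑ k ∈ Finset.Ioo 0 (Fin.last N), S k) - ((N : ℤ) - 1) * S 0) := by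
  have h1 := Fin.sum_univ_succ fun k : Fin (N + 1) => ((k : ℤ) - N) * S k
  have h2 := Fin.sum_univ_castSucc fun k : Fin (N + 1) => ((k : ℤ) - N) * S k
  have h3 := Fin.sum_univ_castSucc S
  have hlast : (0 : Fin (N + 1)) ≠ Fin.last N := by
    intro h
    have := congrArg Fin.val h
    simp at this
    omega
  have hset : (Finset.univ : Finset (Fin (N + 1))) =
      insert 0 (insert (Fin.last N) (Finset.Ioo 0 (Fin.last N))) := by
    ext k
    simp only [Finset.mem_univ, Finset.mem_insert, Finset.mem_Ioo, true_iff]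
    rcases (Fin.zero_le k).eq_or_lt with h | h
    · exact Or.inl h.symm
    · rcases (Fin.le_last k).eq_or_lt with h' | h'
      · exact Or.inr (Or.inl h')
      · exact Or.inr (Or.inr ⟨h, h'⟩)
  have h4 : ∑ k, S k = S 0 + (S (Fin.last N) + ∑ k ∈ Finset.Ioo 0 (Fin.last N), S k) := by
    rw [hset, Finset.sum_insert (by simp [hlast]), Finset.sum_insert (by simp)]
  -- The first two sums telescope to `N * S 0`, because the coefficient of the top level is zero.
  have h5 : ∑ k : Fin N, (1 - (N : ℤ) + k) * (S k.succ - S k.castSucc) =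
      ∑ k : Fin N, (((k.succ : Fin (N + 1)) : ℤ) - N) * S k.succ -
        ∑ k : Fin N, (((k.castSucc : Fin (N + 1)) : ℤ) - N) * S k.castSucc -
        ∑ k : Fin N, S k.castSucc := by
    rw [← Finset.sum_sub_distrib, ← Finset.sum_sub_distrib]
    refine Finset.sum_congr rfl fun k _ => ?_
    simp only [Fin.val_succ, Fin.val_castSucc]
    push_cast
    ring
  simp only [Fin.val_zero, Fin.val_last, Nat.cast_zero, sub_self, zero_mul, add_zero] at h1 h2
  rw [h5]
  linarith

/-- The numerator of the `q`-weight. -/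
def Config.qNumerator (q : ℝ) {x : Fin (d + N) → ℤ} (c : Config y x) : ℝ :=
  ∏ k : Fin N, (q ^ (1 - (N : ℤ) + k)) ^ (c.size k.succ - c.size k.castSucc)

lemma Config.qNumerator_pos {q : ℝ} (hq : 0 < q) {x : Fin (d + N) → ℤ} (c : Config y x) :
    0 < c.qNumerator q :=
  Finset.prod_pos fun _ _ => zpow_pos (zpow_pos hq _) _

lemma prod_zpow_eq {ι : Type*} {q : ℝ} (hq : 0 < q) (s : Finset ι) (e : ι → ℤ) :
    ∏ k ∈ s, q ^ e k = q ^ ∑ k ∈ s, e k := by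
  induction s using Finset.cons_induction with
  | empty => simp
  | cons k s hk ih => rw [Finset.prod_cons, Finset.sum_cons, ih, zpow_add₀ hq.ne']

lemma Config.qNumerator_eq (hN : 1 ≤ N) {q : ℝ} (hq : 0 < q) {x : Fin (d + N) → ℤ}
    (c : Config y x) :
    c.qNumerator q =
      q⁻¹ ^ ((∑ k ∈ Finset.Ioo 0 (Fin.last N), c.size k) - ((N : ℤ) - 1) * c.size 0) := by
  simp_rw [Config.qNumerator, ← zpow_mul]
  rw [prod_zpow_eq hq, sum_mul_sub_eq hN, inv_zpow', neg_sub]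

lemma qWeight_eq (hN : 1 ≤ N) {q : ℝ} (hq : 0 < q) (hy : StrictAnti y)
    {x : Fin (d + N) → ℤ} [Fintype (Config y x)] (hx : StrictAnti x)
    (hlow : ∀ i, -((d : ℤ) + N) ≤ x i) (c : Config y x) :
    qWeight q c = c.qNumerator q / ∑ c' : Config y x, c'.qNumerator q := by
  rw [qWeight, ← c.qNumerator_eq hN hq, skewSchur]
  congr 1
  refine Eq.trans ?_ (det_h_eq_sum hy (a := fun k => q ^ (1 - (N : ℤ) + k))
    (fun k => (zpow_pos hq _).ne') hx hlow)
  congr 2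
  ext i j
  congr 1
  ring

lemma Config.size_zero {x : Fin (d + N) → ℤ} (c : Config y x) :
    c.size 0 = ∑ i : Fin d, (y i + ((i : ℤ) + 1)) :=
  Finset.sum_congr rfl fun i _ => congrArg (· + ((i : ℤ) + 1)) (c.bottom i)

lemma Config.size_last {x : Fin (d + N) → ℤ} (c : Config y x) :
    c.size (Fin.last N) = ∑ i : Fin (d + N), (x i + ((i : ℤ) + 1)) :=
  Finset.sum_congr rfl fun i _ => congrArg (· + ((i : ℤ) + 1)) (c.top i)

lemma Config.sum_size_sub {x : Fin (d + N) → ℤ} (c : Config y x) :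
    ∑ k : Fin N, (c.size k.succ - c.size k.castSucc) = c.size (Fin.last N) - c.size 0 := by
  have h1 := Fin.sum_univ_succ c.size
  have h2 := Fin.sum_univ_castSucc c.size
  rw [Finset.sum_sub_distrib]
  linarith

/-- The two weights of configurations differ by a constant factor. -/
lemma exists_plainWeight_eq {q : ℝ} (hq : 0 < q) (y : Fin d → ℤ) (x : Fin (d + N) → ℤ) :
    ∃ κ : ℝ, 0 < κ ∧ ∀ c : Config y x, c.plainWeight q = κ * c.qNumerator q := by
  -- Since `d + k = (1 - N + k) + (d + N - 1)`, the excess exponent multiplies the total size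
  -- increment, fixed by `x` and `y`. The subtracted sum comes from replacing sums of positions by
  -- sizes.
  refine ⟨q ^ (((d : ℤ) + N - 1) * (∑ i : Fin (d + N), (x i + ((i : ℤ) + 1)) -
      ∑ i : Fin d, (y i + ((i : ℤ) + 1))) - ∑ k : Fin N, ((d : ℤ) + k) * ((d : ℤ) + k + 1)),
    zpow_pos hq _, fun c => ?_⟩
  rw [← c.size_zero, ← c.size_last, ← c.sum_size_sub, Config.plainWeight, Config.weight,
    Config.qNumerator]
  simp only [one_mul, Finset.prod_const_one, mul_one, ← zpow_natCast, ← zpow_mul]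
  rw [prod_zpow_eq hq, prod_zpow_eq hq, ← zpow_add₀ hq.ne']
  congr 1
  rw [Finset.mul_sum, ← Finset.sum_sub_distrib, ← Finset.sum_add_distrib]
  refine Finset.sum_congr rfl fun k _ => ?_
  have h := c.size_succ_sub k
  push_cast at h ⊢
  rw [h]
  ring

open Classical in
lemma measureQ_apply (q : ℝ) {x : Fin (d + N) → ℤ} [Fintype (Config y x)] (S : Set (Config y x)) :
    measureQ q y x S = ∑ c, ENNReal.ofReal (qWeight q c) * if c ∈ S then 1 else 0 := by
  have hS : MeasurableSet S := MeasurableSpace.measurableSet_top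
  rw [measureQ, Measure.sum_apply _ hS, tsum_fintype]
  refine Finset.sum_congr rfl fun c _ => ?_
  rw [Measure.smul_apply, Measure.dirac_apply' _ hS, smul_eq_mul, Set.indicator_apply]
  rfl

open Classical in
lemma measureQ_real_apply {q : ℝ} {x : Fin (d + N) → ℤ} [Fintype (Config y x)]
    (hnonneg : ∀ c : Config y x, 0 ≤ qWeight q c) (S : Set (Config y x)) :
    (measureQ q y x).real S = ∑ c, qWeight q c * if c ∈ S then 1 else 0 := by
  rw [Measure.real, measureQ_apply, ENNReal.toReal_sum]
  · refine Finset.sum_congr rfl fun c _ => ?_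
    rw [ENNReal.toReal_mul, ENNReal.toReal_ofReal (hnonneg c)]
    split_ifs <;> simp
  · intro c _
    split_ifs <;> simp

lemma strictAnti_of_yExt (hy : StrictAnti (yExt N y)) : StrictAnti y := fun i j hij => by
  have h : Fin.castAdd N i < Fin.castAdd N j := hij
  simpa [yExt_castAdd] using hy h

end RedDots

end

/-! ### Normalisation, invertibility and correlation functions of ℙ_q -/

theorem proposition4p2 (d N : ℕ) (hN : 1 ≤ N) (q : ℝ) (hq0 : 0 < q) (hq1 : q < 1)
    (y : Fin d → ℤ) (x : Fin (d + N) → ℤ)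
    (hy : StrictAnti (RedDots.yExt N y)) (hx : StrictAnti x)
    (hxlow : ∀ i, -((d : ℤ) + (N : ℤ)) ≤ x i)
    (hne : Nonempty (RedDots.Config y x)) :
    -- `ℙ_q` is a probability measure with the prescribed weights
    MeasureTheory.IsProbabilityMeasure (RedDots.measureQ q y x) ∧
    (∀ c : RedDots.Config y x, (RedDots.measureQ q y x).real {c} = RedDots.qWeight q c) ∧
    -- the infinite series and the inverse matrices in the definition of the kernel make sense
    (∀ (j : Fin N) (l : Fin (d + N)),
      Summable fun z : ℤ =>
        RedDots.phi q (d + (j + 1)) ⊥ z * RedDots.psiLevel q y x (j + 1) l z) ∧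
    (∀ (n : Fin (N + 1)) (j : Fin N) (v : ℤ), (j : ℕ) < n →
      Summable fun z : ℤ =>
        RedDots.phi q (d + (j + 1)) ⊥ z *
          RedDots.phiConv q (d + (j + 1) + 1) (d + 1 + n) z v) ∧
    IsUnit (RedDots.H q y x).det ∧
    IsUnit (RedDots.M q y x).det ∧
    -- the process of red dots is determinantal with kernel `𝕂_q`
    RedDots.IsDeterminantal (RedDots.measureQ q y x) RedDots.Config.dots
      (fun p p' => RedDots.kernel q y x p.1 p.2 p'.1 p'.2) := by
  classical
  open RedDots in
  have hy' : StrictAnti y := strictAnti_of_yExt hy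
  have : Finite (Config y x) := Config.finite y hx
  have : Fintype (Config y x) := Fintype.ofFinite _
  obtain ⟨κ, hκ, hκc⟩ := exists_plainWeight_eq (N := N) hq0 y x
  have hZ : 0 < ∑ c : Config y x, c.qNumerator q :=
    Finset.sum_pos (fun c _ => c.qNumerator_pos hq0) Finset.univ_nonempty
  have hweight := qWeight_eq hN hq0 hy' hx hxlow
  have hnonneg : ∀ c : Config y x, 0 ≤ qWeight q c := fun c => by
    rw [hweight]
    exact div_nonneg (c.qNumerator_pos hq0).le hZ.le
  have hH : IsUnit (H q y x).det := by
    have hdet := det_h_eq_sum hy' (a := fun k => q ^ (d + k)) (fun k => (pow_pos hq0 _).ne')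
      hx hxlow
    refine isUnit_iff_ne_zero.2 (ne_of_gt (lt_of_lt_of_eq ?_ hdet.symm))
    exact Finset.sum_pos (fun c _ => Finset.prod_pos fun k _ => zpow_pos (pow_pos hq0 _) _)
      Finset.univ_nonempty
  have hGdet : (topMatrix q y x).det = κ * ∑ c : Config y x, c.qNumerator q := by
    rw [det_topMatrix hq0 hq1 hy' hx hxlow, Finset.mul_sum]
    exact Finset.sum_congr rfl fun c _ => hκc c
  have hG : IsUnit (topMatrix q y x).det := by
    rw [hGdet]
    exact (mul_pos hκ hZ).ne'.isUnit
  refine ⟨⟨?_⟩, fun c => ?_, fun j l => (hasSum_phi_bot_mul_psiLevel hq0 hq1 y x j l).summable,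
    fun n j v _ => summable_phi_bot_mul_phiConv hq0 hq1 _ _ v, hH, ?_, fun r p hp => ?_⟩
  · rw [measureQ_apply]
    simp only [Set.mem_univ, if_true, mul_one]
    rw [← ENNReal.ofReal_sum_of_nonneg fun c _ => hnonneg c]
    simp_rw [hweight]
    rw [← Finset.sum_div, div_self hZ.ne', ENNReal.ofReal_one]
  · rw [measureQ_real_apply hnonneg]
    simp
  · rw [M_eq_topMatrix_mul hq0 hq1, Matrix.det_mul]
    exact hG.mul (isUnit_det_inv_transpose hH)
  · rw [measureQ_real_apply hnonneg, kernelMatrix_eq hq0 hq1 hH]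
    -- The determinant of `topMatrix` is `κ` times the partition function, so multiplying by it
    -- turns probabilities into plain weights.
    refine mul_left_cancel₀ hG.ne_zero ?_
    rw [← sum_weight_covering hq0 hq1 hy' hx hxlow hG hp, Finset.mul_sum]
    refine Finset.sum_congr rfl fun c _ => ?_
    rw [← mul_assoc, hκc, hweight, hGdet]
    congr 1
    · field_simp
    · simp
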